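/- Let $\lambda=\sum_i x_i\,dy_i-y_i\,dx_i$, $\omega=\sum_i dx_i\wedge dy_i$ and $\Omega=dz_1\wedge\dots\wedge dz_n$ on $\mathbb C^n$, $n\ge 1$, let $J$ be the standard complex structure, and let $0<T\le\infty$. Let $M$ be an oriented smooth $n$-manifold and let $F_t:M\to\mathbb C^n$, $0\le t<T$, be a smooth (up to $t=0$) family of Lagrangian immersions moving by mean curvature, $\frac{d}{dt}F_t=H$. Write $L_t$ for the immersed submanifold $F_t$, and $\mathbf x$ for its position vector; functions on $L_t$ are functions on $M$, $\nabla$ and $\Delta$ are the gradient and Laplacian of the induced metric, $\top$ and $\perp$ are the tangential and normal parts, and $\frac{d}{dt}$ is the derivative at a fixed point of $M$ (one-sided at $t=0$). A Lagrangian angle of $L_t$ is a function $\theta_t$ with $\Omega|_{L_t}=e^{i\theta_t}\mathrm{vol}_{L_t}$. Assume that $L_0$ is zero-Maslov class, i.e. has a smooth single-valued Lagrangian angle, and that $L_0$ is rational, i.e. for some $a\in\mathbb R$ $$\lambda\bigl(H_1(L_0,\mathbb Z)\bigr)=\{a\,2k\pi \mid k\in\mathbb Z\}.$$ Then there is a smooth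 family $(\theta_t)_{0\le t<T}$ of single-valued Lagrangian angles of $(L_t)$, and every such family satisfies $\frac{d\theta_t}{dt}=\Delta\theta_t$ and the following. 1. There is a smooth family of multivalued functions $\beta_t:L_t\to\mathbb R/2\pi a\mathbb Z$, $0\le t<T$ (real-valued functions if $a=0$), such that $$\nabla\beta_t=(J\mathbf x)^{\top}\qquad\text{and}\qquad \frac{d\beta_t}{dt}=\Delta\beta_t-2\theta_t .$$ 2. For every family $(\beta_t)$ as in 1, every $t_0\in\mathbb R$ and every $k\in\mathbb Z$, the function $$u_t=\cos\left(\frac{k\,(\beta_t+2(t-t_0)\theta_t)}{a}\right)$$ (with the divisor $a$ replaced by $1$ if $a=0$) is well defined and smooth on $L_t$, and $$\frac{du_t}{dt}=\Delta u_t+u_t\left|\frac{k\,(\mathbf x^{\perp}+2(t_0-t)H)}{a}\right|^2 .$$ -/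

import Mathlib

open Set Function
open scoped Manifold ContDiff Topology

namespace LagrangianMCF

noncomputable section

/-! ### The ambient space `ℂⁿ` -/

/-- The model space `ℝⁿ` of the manifolds. -/
abbrev E (n : ℕ) : Type := EuclideanSpace ℝ (Fin n)

/-- The ambient space `ℂⁿ`; its real inner product is the Euclidean one of `ℝ²ⁿ`. -/
abbrev V (n : ℕ) : Type := EuclideanSpace ℂ (Fin n)

/-- The standard complex structure `J` of `ℂⁿ`. -/
def J {n : ℕ} (v : V n) : V n := Complex.I • v

/-- The standard symplectic form `ω = ∑ dxᵢ ∧ dyᵢ`. -/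
def omega {n : ℕ} (v w : V n) : ℝ :=
  ∑ i, ((v i).re * (w i).im - (v i).im * (w i).re)

/-- The Liouville form `λ = ∑ xᵢ dyᵢ - yᵢ dxᵢ` at the point `x`, applied to `v`. -/
def liouville {n : ℕ} (x v : V n) : ℝ :=
  ∑ i, ((x i).re * (v i).im - (x i).im * (v i).re)

/-- The form `Ω = dz₁ ∧ … ∧ dzₙ` applied to `v₁, …, vₙ`. -/
def Omega {n : ℕ} (v : Fin n → V n) : ℂ :=
  (Matrix.of fun i j => v j i).det

/-- The time interval `[0, T)`, where `T` may be infinite. -/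
def timeInterval (T : EReal) : Set ℝ := {t | 0 ≤ t ∧ (t : EReal) < T}

/-- The partial derivative `∂ᵢ h` of a map on `ℝⁿ`. -/
def pderiv {n : ℕ} {W : Type*} [NormedAddCommGroup W] [NormedSpace ℝ W]
    (i : Fin n) (h : E n → W) (x : E n) : W :=
  fderiv ℝ h x (EuclideanSpace.single i 1)

section Geometry

variable {n : ℕ} {M : Type*} [TopologicalSpace M] [ChartedSpace (E n) M]

/-- The set `[0, T) × M`. -/
def spacetime (M : Type*) (T : EReal) : Set (ℝ × M) := timeInterval T ×ˢ univ

/-! ### Geometry of an immersion `F : M → ℂⁿ`, computed at `p` in the chart around `p` -/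

/-- The expression of a map on `M` in the chart around `p`. -/
def localRep {W : Type*} (f : M → W) (p : M) : E n → W :=
  f ∘ (extChartAt 𝓘(ℝ, E n) p).symm

/-- The coordinates of `p` in the chart around `p`. -/
def coord (p : M) : E n := extChartAt 𝓘(ℝ, E n) p p

/-- The induced metric `gᵢⱼ = ⟨∂ᵢF, ∂ⱼF⟩` in the chart around `p`. -/
def metric (F : M → V n) (p : M) (x : E n) : Matrix (Fin n) (Fin n) ℝ :=
  Matrix.of fun i j => inner ℝ (pderiv i (localRep F p) x) (pderiv j (localRep F p) x)

/-- The Christoffel symbols `Γᵏᵢⱼ = ½ ∑ₗ gᵏˡ (∂ᵢgⱼₗ + ∂ⱼgᵢₗ - ∂ₗgᵢⱼ)` of the induced metric. -/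
def christoffel (F : M → V n) (p : M) (x : E n) (k i j : Fin n) : ℝ :=
  (1 / 2) * ∑ l, (metric F p x)⁻¹ k l *
    (pderiv i (fun y => metric F p y j l) x + pderiv j (fun y => metric F p y i l) x
      - pderiv l (fun y => metric F p y i j) x)

/-- The Laplacian `Δf = ∑ gⁱʲ (∂ᵢ∂ⱼf - ∑ₖ Γᵏᵢⱼ ∂ₖf)` of the induced metric, at `p`. -/
def laplacian (F : M → V n) (f : M → ℝ) (p : M) : ℝ :=
  ∑ i, ∑ j, (metric F p (coord p))⁻¹ i j *
    (pderiv i (pderiv j (localRep f p)) (coord p)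
      - ∑ k, christoffel F p (coord p) k i j * pderiv k (localRep f p) (coord p))

/-- The gradient `∇f = ∑ gⁱʲ ∂ⱼf ∂ᵢF` for the induced metric, as a vector of `ℂⁿ` tangent to the
immersed submanifold. -/
def gradient (F : M → V n) (f : M → ℝ) (p : M) : V n :=
  ∑ i, ∑ j, ((metric F p (coord p))⁻¹ i j * pderiv j (localRep f p) (coord p)) •
    pderiv i (localRep F p) (coord p)

/-- The differential of `F` at `p`. -/
def differential (F : M → V n) (p : M) : TangentSpace 𝓘(ℝ, E n) p →L[ℝ] V n :=
  mfderiv 𝓘(ℝ, E n) 𝓘(ℝ, V n) F p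

/-- The tangent plane of the immersed submanifold, a real subspace of `ℂⁿ`. -/
def tangentPlane (F : M → V n) (p : M) : Submodule ℝ (V n) :=
  LinearMap.range (differential F p).toLinearMap

/-- The tangential part `v^⊤` at `p` of a vector of `ℂⁿ`. -/
def tangentialPart (F : M → V n) (p : M) (v : V n) : V n :=
  (tangentPlane F p).starProjection v

/-- The normal part `v^⊥` at `p` of a vector of `ℂⁿ`. -/
def normalPart (F : M → V n) (p : M) (v : V n) : V n :=
  (tangentPlane F p)ᗮ.starProjection v

/-- The mean curvature vector: the trace `∑ gⁱʲ Aᵢⱼ` of the second fundamental form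
`Aᵢⱼ = (∂ᵢ∂ⱼF)^⊥`. -/
def meanCurvature (F : M → V n) (p : M) : V n :=
  ∑ i, ∑ j, (metric F p (coord p))⁻¹ i j •
    normalPart F p (pderiv i (pderiv j (localRep F p)) (coord p))

/-- `F` is a smooth solution `(F_t)_{0 ≤ t < T}` of mean curvature flow (by immersions), all of
whose time slices are Lagrangian. -/
structure IsLagrangianMCF (T : EReal) (F : ℝ → M → V n) : Prop where
  smooth : ContMDiffOn (𝓘(ℝ, ℝ).prod 𝓘(ℝ, E n)) 𝓘(ℝ, V n) ∞ (uncurry F) (spacetime M T)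
  immersion : ∀ t ∈ timeInterval T, ∀ p, Injective (differential (F t) p)
  lagrangian : ∀ t ∈ timeInterval T, ∀ p, ∀ v w : TangentSpace 𝓘(ℝ, E n) p,
    omega (differential (F t) p v) (differential (F t) p w) = 0
  flow : ∀ t ∈ timeInterval T, ∀ p,
    HasDerivWithinAt (fun s => F s p) (meanCurvature (F t) p) (timeInterval T) t

/-! ### The Lagrangian angle -/

/-- `θ` is a single-valued Lagrangian angle of the immersion `F` of `(M, o)`:
`F^*Ω = e^{iθ} vol`, where `vol` is the volume form of the induced metric and the orientation `o`,
whose value on a positively oriented basis is `√det(⟨dF bᵢ, dF bⱼ⟩)`. -/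
def IsLagrangianAngle (F : M → V n)
    (o : ∀ p : M, Orientation ℝ (TangentSpace 𝓘(ℝ, E n) p) (Fin n)) (θ : M → ℝ) : Prop :=
  ∀ p, ∀ b : Module.Basis (Fin n) ℝ (TangentSpace 𝓘(ℝ, E n) p), b.orientation = o p →
    Omega (fun j => differential F p (b j)) =
      Complex.exp (θ p * Complex.I) *
        (√(Matrix.of fun i j : Fin n =>
          (inner ℝ (differential F p (b i)) (differential F p (b j)) : ℝ)).det : ℝ)

/-- `F` is zero-Maslov class: its Lagrangian angle is a (smooth) single-valued function. -/
def IsZeroMaslov (F : M → V n)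
    (o : ∀ p : M, Orientation ℝ (TangentSpace 𝓘(ℝ, E n) p) (Fin n)) : Prop :=
  ∃ θ : M → ℝ, ContMDiff 𝓘(ℝ, E n) 𝓘(ℝ, ℝ) ∞ θ ∧ IsLagrangianAngle F o θ

/-- `(θ_t)` is a smooth family of Lagrangian angles of the immersions `(F_t)`. -/
def IsAngleFamily (T : EReal) (F : ℝ → M → V n)
    (o : ∀ p : M, Orientation ℝ (TangentSpace 𝓘(ℝ, E n) p) (Fin n)) (θ : ℝ → M → ℝ) : Prop :=
  ContMDiffOn (𝓘(ℝ, ℝ).prod 𝓘(ℝ, E n)) 𝓘(ℝ, ℝ) ∞ (uncurry θ) (spacetime M T) ∧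
    ∀ t ∈ timeInterval T, IsLagrangianAngle (F t) o (θ t)

/-! ### Integer 1-cycles and rational Lagrangians -/

/-- Smooth singular 1-simplices of `M`, that is smooth paths `σ : [0, 1] → M` (given on `ℝ`). -/
def SmoothPath (n : ℕ) (M : Type*) [TopologicalSpace M] [ChartedSpace (E n) M] : Type _ :=
  {σ : ℝ → M // ContMDiff 𝓘(ℝ, ℝ) 𝓘(ℝ, E n) ∞ σ}

/-- The boundary `∑ c(σ) (σ(1) - σ(0))` of a smooth integer 1-chain. -/
def boundary (c : SmoothPath n M →₀ ℤ) : M →₀ ℤ :=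
  c.sum fun σ m => m • (Finsupp.single (σ.1 1) 1 - Finsupp.single (σ.1 0) 1)

/-- The integral `∫_c F^*λ` of the Liouville form over a smooth integer 1-chain. -/
def liouvilleIntegral (F : M → V n) (c : SmoothPath n M →₀ ℤ) : ℝ :=
  c.sum fun σ m => (m : ℝ) * ∫ s in (0 : ℝ)..1, liouville (F (σ.1 s)) (deriv (F ∘ σ.1) s)

/-- The set `λ(H₁(L, ℤ))` of the integrals of the Liouville form over the integer 1-cycles. -/
def liouvillePeriods (F : M → V n) : Set ℝ :=
  {r | ∃ c : SmoothPath n M →₀ ℤ, boundary c = 0 ∧ liouvilleIntegral F c = r}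

/-- `F` is rational with constant `a`: `λ(H₁(L, ℤ)) = {a 2kπ | k ∈ ℤ}` (exact when `a = 0`). -/
def IsRational (F : M → V n) (a : ℝ) : Prop :=
  liouvillePeriods F = {r | ∃ k : ℤ, r = a * (2 * k * Real.pi)}

/-! ### Multivalued functions, that is functions with values in `ℝ / 2πaℤ` -/

/-- `b` is a smooth real-valued branch of the multivalued function `β` on the part of
`[0, T) × M` in the open set `U`. -/
structure IsBranch (T : EReal) {a : ℝ} (β : ℝ → M → AddCircle (2 * Real.pi * a))
    (U : Set (ℝ × M)) (b : ℝ → M → ℝ) : Prop where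
  isOpen : IsOpen U
  smooth : ContMDiffOn (𝓘(ℝ, ℝ).prod 𝓘(ℝ, E n)) 𝓘(ℝ, ℝ) ∞ (uncurry b) (U ∩ spacetime M T)
  lift : ∀ t p, (t, p) ∈ U ∩ spacetime M T → (b t p : AddCircle (2 * Real.pi * a)) = β t p

/-- `(β_t)` is a smooth family of multivalued functions with `∇β_t = (J𝐱)^⊤`: it has smooth
branches around every point of `[0, T) × M`, and all branches have this gradient. -/
structure IsLiouvillePrimitive (T : EReal) (F : ℝ → M → V n) {a : ℝ}
    (β : ℝ → M → AddCircle (2 * Real.pi * a)) : Prop where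
  exists_branch : ∀ z ∈ spacetime M T, ∃ U b, z ∈ U ∧ IsBranch (n := n) T β U b
  gradient_eq : ∀ U b, IsBranch (n := n) T β U b → ∀ t p, (t, p) ∈ U ∩ spacetime M T →
    gradient (F t) (b t) p = tangentialPart (F t) p (J (F t p))

/-- The equation `dβ_t/dt = Δβ_t - 2θ_t`, for all branches of the multivalued functions `β_t`. -/
def LiouvilleEvolution (T : EReal) (F : ℝ → M → V n) (θ : ℝ → M → ℝ) {a : ℝ}
    (β : ℝ → M → AddCircle (2 * Real.pi * a)) : Prop :=
  ∀ U b, IsBranch (n := n) T β U b → ∀ t p, (t, p) ∈ U ∩ spacetime M T →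
    HasDerivWithinAt (fun s => b s p) (laplacian (F t) (b t) p - 2 * θ t p) (timeInterval T) t

/-- The number by which one divides in `cos (k (β_t + 2 (t - t₀) θ_t) / a)`: it is `a`, except that
one takes `1` in the exact case `a = 0`. -/
def divisor (a : ℝ) : ℝ := open Classical in if a = 0 then 1 else a

end Geometry

end

end LagrangianMCF

namespace LagrangianMCF

noncomputable section

/-! ### Linear algebra of Lagrangian frames in `ℂⁿ` -/

section LinearAlgebra

variable {n : ℕ}

/-! A Lagrangian frame is a complex basis of `ℂⁿ` whose Hermitian Gram matrix is real. Hence `J`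
exchanges tangent and normal spaces, `|Ω|` is the volume, and the logarithmic derivative of `Ω`
along a moving frame is a trace (`fderivWithin_Omega`). The imaginary part of that trace is `dθ`, in
space and time at once (`IsAngleFamily.stDiff_eq`). In space directions the total symmetry of
`⟨J∂ᵢF, ∂ⱼ∂ₖF⟩` turns it into `∂ᵢθ = ⟨J∂ᵢF, H⟩`, that is `H = J∇θ`; in the time direction, with `∂ₜF
= H`, it becomes `dθ/dt = Δθ` (`IsAngleFamily.heat`). An angle for later times is obtained by
following the argument of `Ω` at each fixed point of `M`, starting from the given angle at time 0.

The central fact is that the 1-form `α = ⟨JF, dF⟩ - 2θ dt` on `[0, T) × M` is closed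
(`liouvilleForm_closed`). The differential of its first term is `2F*ω`; this vanishes on time
slices, and `∂ₜF = H = J∇θ` gives `F*ω = dθ ∧ dt`. So `α` has local primitives. Its periods over the
slice `t = 0` lie in `2πaℤ` by rationality, so the primitives glue to some `β` with values in
`ℝ/2πaℤ`: integrate over chains at time 0, then follow each point in time
(`exists_isLocalPrimitive`). Rationality is needed at time 0 only. The space part of `dβ = α` is `∇β
= (JF)^⊤`, and the time part is `dβ/dt = ⟨JF, H⟩ - 2θ`, where `⟨JF, H⟩ = Δβ`
(`IsLagrangianMCF.laplacian_primitive`).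

Finally `w = β + 2(t - t₀)θ` solves the heat equation, since differentiating the factor `2(t - t₀)`
cancels `-2θ`. With `κ = k/a` the chain rule gives `du/dt = Δu + κ²|∇w|² u` for `u = cos(κw)`, and
`∇w = J(𝐱^⊥ + 2(t₀ - t)H)` has the required length (`norm_normal_sq`). Another branch of `β` changes
`κw` by a multiple of `2π`.

At `t = 0` time derivatives are one-sided, so the calculus uses derivatives within `[0, T) × S` with
`S` open; these sets have unique derivatives and lie in the closure of their interior, which also
gives symmetric second derivatives. -/

lemma inner_real_eq_re (v w : V n) : inner ℝ v w = (inner ℂ v w).re := by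
  rw [PiLp.inner_apply, PiLp.inner_apply, Complex.re_sum]
  exact Finset.sum_congr rfl fun i _ => rfl

lemma inner_J_eq_im (v w : V n) : inner ℝ (J v) w = (inner ℂ v w).im := by
  rw [inner_real_eq_re, J, inner_smul_left]; simp

lemma omega_eq_inner (v w : V n) : omega v w = inner ℝ (J v) w := by
  rw [inner_J_eq_im, PiLp.inner_apply, Complex.im_sum, omega]
  refine Finset.sum_congr rfl fun i _ => ?_
  simp [mul_comm]; ring

lemma liouville_eq_inner (v w : V n) : liouville v w = inner ℝ (J v) w :=
  omega_eq_inner v w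

lemma inner_J_right (v w : V n) : inner ℝ v (J w) = - inner ℝ (J v) w := by
  rw [inner_J_eq_im, inner_real_eq_re, J, inner_smul_right]; simp

/-- Multiplication by `i` as a real continuous linear map. -/
def JL (n : ℕ) : V n →L[ℝ] V n :=
  (Complex.I • ContinuousLinearMap.id ℂ (V n)).restrictScalars ℝ

@[simp] lemma JL_apply (v : V n) : JL n v = J v := rfl

/-- The Gram matrix of a family of vectors of `ℂⁿ`. -/
def gramMat (e : Fin n → V n) : Matrix (Fin n) (Fin n) ℝ :=
  Matrix.of fun i j => inner ℝ (e i) (e j)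

/-- `Ω` as an alternating map. -/
def OmegaAlt (n : ℕ) : V n [⋀^Fin n]→ₗ[ℂ] ℂ :=
  (Matrix.detRowAlternating (R := ℂ) (n := Fin n)).compLinearMap
    (WithLp.linearEquiv 2 ℂ (Fin n → ℂ)).toLinearMap

lemma OmegaAlt_apply (e : Fin n → V n) : OmegaAlt n e = Omega e := by
  rw [Omega, ← Matrix.det_transpose]; rfl

/-- `e` is a basis of a Lagrangian subspace. -/
structure IsLagFrame (e : Fin n → V n) : Prop where
  linearIndependent : LinearIndependent ℝ e
  lagrangian : ∀ i j, inner ℝ (J (e i)) (e j) = 0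

variable {e : Fin n → V n}

lemma gramMat_symm (e : Fin n → V n) (i j : Fin n) : gramMat e i j = gramMat e j i :=
  real_inner_comm (e j) (e i)

lemma gramMat_inv_symm (e : Fin n → V n) (i j : Fin n) :
    (gramMat e)⁻¹ i j = (gramMat e)⁻¹ j i := by
  have h : (gramMat e).transpose = gramMat e := by
    ext i j; exact gramMat_symm e j i
  conv_lhs => rw [← h, ← Matrix.transpose_nonsing_inv]
  rfl

lemma IsLagFrame.det_pos (he : IsLagFrame e) : 0 < (gramMat e).det :=
  (Matrix.posDef_gram_of_linearIndependent (𝕜 := ℝ) he.linearIndependent).det_pos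

lemma IsLagFrame.inv_mul (he : IsLagFrame e) : (gramMat e)⁻¹ * gramMat e = 1 :=
  Matrix.nonsing_inv_mul _ he.det_pos.ne'.isUnit

/-- The matrix with columns `e j`. -/
def colMat (e : Fin n → V n) : Matrix (Fin n) (Fin n) ℂ := Matrix.of fun i j => e j i

/-- The imaginary part of the Hermitian product is `ω`, which vanishes on a Lagrangian plane. -/
lemma IsLagFrame.inner_eq (he : IsLagFrame e) (i j : Fin n) :
    inner ℂ (e i) (e j) = (gramMat e i j : ℂ) := by
  apply Complex.ext
  · exact (inner_real_eq_re _ _).symm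
  · rw [← inner_J_eq_im, he.lagrangian]; rfl

lemma IsLagFrame.conjTranspose_mul (he : IsLagFrame e) :
    (colMat e).conjTranspose * colMat e = (gramMat e).map Complex.ofRealHom := by
  ext i j
  rw [Matrix.map_apply, Complex.ofRealHom_eq_coe, ← he.inner_eq, PiLp.inner_apply, Matrix.mul_apply]
  refine Finset.sum_congr rfl fun k _ => ?_
  simp [colMat, mul_comm]

lemma IsLagFrame.normSq_Omega (he : IsLagFrame e) :
    Complex.normSq (Omega e) = (gramMat e).det := by
  have h := congrArg Matrix.det he.conjTranspose_mul
  rw [Matrix.det_mul, Matrix.det_conjTranspose] at h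
  have h2 : ((gramMat e).map Complex.ofRealHom).det = ((gramMat e).det : ℂ) :=
    (RingHom.map_det Complex.ofRealHom (gramMat e)).symm
  rw [h2] at h
  have : (Complex.normSq (Omega e) : ℂ) = ((gramMat e).det : ℂ) := by
    rw [← h, Complex.normSq_eq_conj_mul_self]; rfl
  exact_mod_cast this

lemma IsLagFrame.norm_Omega (he : IsLagFrame e) : ‖Omega e‖ = √(gramMat e).det := by
  rw [← he.normSq_Omega, Complex.normSq_eq_norm_sq, Real.sqrt_sq (norm_nonneg _)]

lemma IsLagFrame.Omega_ne_zero (he : IsLagFrame e) : Omega e ≠ 0 := by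
  intro h
  have := he.normSq_Omega
  rw [h, map_zero] at this
  exact he.det_pos.ne this

lemma IsLagFrame.mul_eq_one (he : IsLagFrame e) :
    colMat e * ((gramMat e)⁻¹.map Complex.ofRealHom * (colMat e).conjTranspose) = 1 := by
  rw [mul_eq_one_comm, Matrix.mul_assoc, he.conjTranspose_mul, ← Matrix.map_mul, he.inv_mul]
  simp

/-- If `A` has columns `e` and `G` is the Gram matrix, then `A*A = G`. Thus `G⁻¹A*` is a left
inverse of the square matrix `A`, hence also a right inverse: the frame is a complex basis. -/
lemma IsLagFrame.complex_expansion (he : IsLagFrame e) (v : V n) :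
    v = ∑ k, (∑ l, ((gramMat e)⁻¹ k l : ℂ) * inner ℂ (e l) v) • e k := by
  have h := congrArg (fun A => A.mulVec v.ofLp) he.mul_eq_one
  simp only [Matrix.one_mulVec, ← Matrix.mulVec_mulVec] at h
  ext i
  rw [← h]
  simp only [WithLp.ofLp_sum, WithLp.ofLp_smul, Finset.sum_apply, Pi.smul_apply, smul_eq_mul]
  rw [Matrix.mulVec, dotProduct]
  refine Finset.sum_congr rfl fun k _ => ?_
  rw [mul_comm]
  congr 1
  rw [Matrix.mulVec, dotProduct]
  refine Finset.sum_congr rfl fun l _ => ?_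
  simp only [Matrix.map_apply, Complex.ofRealHom_eq_coe]
  congr 1
  rw [PiLp.inner_apply, Matrix.mulVec, dotProduct]
  refine Finset.sum_congr rfl fun m _ => ?_
  simp [colMat, mul_comm]

/-- The component of `v` in the span of `e`. -/
def tanComp (e : Fin n → V n) (v : V n) : V n :=
  ∑ k, ∑ l, ((gramMat e)⁻¹ k l * inner ℝ (e l) v) • e k

/-- The component of `v` in the span of `J e`. -/
def norComp (e : Fin n → V n) (v : V n) : V n :=
  ∑ k, ∑ l, ((gramMat e)⁻¹ k l * inner ℝ (J (e l)) v) • J (e k)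

/-- The real parts of the complex coefficients give the tangential component and the imaginary parts
the component along `J e`. -/
lemma IsLagFrame.expansion (he : IsLagFrame e) (v : V n) : v = tanComp e v + norComp e v := by
  conv_lhs => rw [he.complex_expansion v]
  simp only [tanComp, norComp, ← Finset.sum_add_distrib, Finset.sum_smul]
  refine Finset.sum_congr rfl fun k _ => Finset.sum_congr rfl fun l _ => ?_
  rw [inner_J_eq_im, inner_real_eq_re, J, ← Complex.re_add_im (inner ℂ (e l) v), mul_add, add_smul]
  simp only [Complex.add_re, Complex.ofReal_re, Complex.mul_re, Complex.I_re, Complex.I_im,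
    Complex.ofReal_im, Complex.add_im, Complex.mul_im]
  simp only [← Complex.coe_smul, smul_smul]
  congr 2 <;> push_cast <;> ring

lemma Omega_update (e : Fin n → V n) (j : Fin n) (c : Fin n → ℂ) :
    Omega (update e j (∑ k, c k • e k)) = c j * Omega e := by
  rw [← OmegaAlt_apply, ← OmegaAlt_apply, AlternatingMap.map_update_sum]
  rw [Finset.sum_eq_single j]
  · rw [AlternatingMap.map_update_smul, update_eq_self, smul_eq_mul]
  · intro k _ hk
    rw [AlternatingMap.map_update_smul, AlternatingMap.map_update_self _ _ hk.symm, smul_zero]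
  · simp

/-- The algebraic half of Jacobi's formula: `Ω` is alternating, so replacing `e j` by a vector only
sees its coefficient along `e j`. -/
lemma IsLagFrame.sum_Omega_update (he : IsLagFrame e) (w : Fin n → V n) :
    ∑ j, Omega (update e j (w j)) =
      Omega e * ∑ j, ∑ k, ((gramMat e)⁻¹ j k : ℂ) * inner ℂ (e k) (w j) := by
  rw [Finset.mul_sum]
  refine Finset.sum_congr rfl fun j _ => ?_
  conv_lhs => rw [he.complex_expansion (w j), Omega_update, mul_comm]

lemma IsLagFrame.normSq_of_orthogonal (he : IsLagFrame e) {v : V n}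
    (hv : ∀ i, inner ℝ (e i) v = 0) :
    ‖v‖ ^ 2 = ∑ k, ∑ l, (gramMat e)⁻¹ k l * (inner ℝ (J (e l)) v * inner ℝ (J (e k)) v) := by
  have h := he.expansion v
  have h0 : tanComp e v = 0 := by simp [tanComp, hv]
  rw [h0, zero_add] at h
  rw [← real_inner_self_eq_norm_sq]
  have h2 : inner ℝ v v = inner ℝ (norComp e v) v := by rw [← h]
  rw [h2, norComp, sum_inner]
  refine Finset.sum_congr rfl fun k _ => ?_
  rw [sum_inner]
  refine Finset.sum_congr rfl fun l _ => ?_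
  rw [real_inner_smul_left, mul_assoc]

lemma IsLagFrame.inner_tanComp (he : IsLagFrame e) (i : Fin n) (v : V n) :
    inner ℝ (e i) (tanComp e v) = inner ℝ (e i) v := by
  conv_rhs => rw [he.expansion v, inner_add_right]
  have : inner ℝ (e i) (norComp e v) = 0 := by
    simp [norComp, inner_sum, real_inner_smul_right, inner_J_right, he.lagrangian]
  rw [this, add_zero]

lemma IsLagFrame.inner_norComp (he : IsLagFrame e) (i : Fin n) (v : V n) :
    inner ℝ (e i) (norComp e v) = 0 := by
  simp [norComp, inner_sum, real_inner_smul_right, inner_J_right, he.lagrangian]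

lemma tanComp_mem (e : Fin n → V n) (v : V n) : tanComp e v ∈ Submodule.span ℝ (range e) :=
  Submodule.sum_mem _ fun k _ => Submodule.sum_mem _ fun _ _ =>
    Submodule.smul_mem _ _ (Submodule.subset_span (mem_range_self k))

lemma mem_span_orthogonal {e : Fin n → V n} {v : V n} :
    v ∈ (Submodule.span ℝ (range e))ᗮ ↔ ∀ i, inner ℝ (e i) v = 0 := by
  rw [Submodule.mem_orthogonal]
  constructor
  · exact fun h i => h _ (Submodule.subset_span (mem_range_self i))
  · intro h u hu
    induction hu using Submodule.span_induction with
    | mem x hx => obtain ⟨i, rfl⟩ := hx; exact h i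
    | zero => simp
    | add x y _ _ hx hy => rw [inner_add_left, hx, hy, add_zero]
    | smul a x _ hx => rw [real_inner_smul_left, hx, mul_zero]

lemma IsLagFrame.starProjection_span (he : IsLagFrame e) (v : V n) :
    (Submodule.span ℝ (range e)).starProjection v = tanComp e v := by
  refine Submodule.eq_starProjection_of_mem_of_inner_eq_zero (tanComp_mem e v) fun w hw => ?_
  have : v - tanComp e v ∈ (Submodule.span ℝ (range e))ᗮ := by
    rw [mem_span_orthogonal]
    intro i
    rw [inner_sub_right, he.inner_tanComp, sub_self]
  rw [real_inner_comm]
  exact this w hw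

lemma IsLagFrame.starProjection_orthogonal (he : IsLagFrame e) (v : V n) :
    (Submodule.span ℝ (range e))ᗮ.starProjection v = norComp e v := by
  rw [Submodule.starProjection_orthogonal_val, he.starProjection_span, sub_eq_iff_eq_add']
  exact he.expansion v

end LinearAlgebra

/-! ### Calculus on `[0, T) × S` with one-sided time derivatives -/

section TimeInterval

variable {T : EReal}

lemma convex_timeInterval (T : EReal) : Convex ℝ (timeInterval T) := by
  apply OrdConnected.convex
  refine ⟨fun x hx y hy z hz => ⟨hx.1.trans hz.1, lt_of_le_of_lt ?_ hy.2⟩⟩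
  exact EReal.coe_le_coe_iff.2 hz.2

lemma zero_mem_timeInterval (hT : 0 < T) : (0 : ℝ) ∈ timeInterval T := ⟨le_rfl, by simpa using hT⟩

lemma interior_timeInterval_nonempty (hT : 0 < T) : (interior (timeInterval T)).Nonempty := by
  obtain ⟨r, h0, hr⟩ := EReal.lt_iff_exists_real_btwn.1 hT
  have h0' : (0 : ℝ) < r := by exact_mod_cast h0
  refine ⟨r / 2, ?_⟩
  rw [mem_interior]
  refine ⟨Ioo 0 r, fun x hx => ⟨hx.1.le, lt_trans ?_ hr⟩, isOpen_Ioo, by constructor <;> linarith⟩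
  exact EReal.coe_lt_coe_iff.2 hx.2

lemma uniqueDiffOn_timeInterval (hT : 0 < T) : UniqueDiffOn ℝ (timeInterval T) :=
  uniqueDiffOn_convex (convex_timeInterval T) (interior_timeInterval_nonempty hT)

variable {X : Type*} [NormedAddCommGroup X] [NormedSpace ℝ X]

lemma uniqueDiffOn_timeInterval_prod (hT : 0 < T) {S : Set X} (hS : IsOpen S) :
    UniqueDiffOn ℝ (timeInterval T ×ˢ S) :=
  (uniqueDiffOn_timeInterval hT).prod hS.uniqueDiffOn

/-- Needed for the symmetry of second derivatives at the boundary points `t = 0`, where it is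
inherited from the interior. -/
lemma timeInterval_prod_subset_closure {X : Type*} [TopologicalSpace X] (hT : 0 < T) {S : Set X} (hS : IsOpen S) :
    timeInterval T ×ˢ S ⊆ closure (interior (timeInterval T ×ˢ S)) := by
  rw [interior_prod_eq, closure_prod_eq, hS.interior_eq,
    (convex_timeInterval T).closure_interior_eq_closure_of_nonempty_interior
      (interior_timeInterval_nonempty hT)]
  exact prod_mono subset_closure subset_closure

variable {W : Type*} [NormedAddCommGroup W] [NormedSpace ℝ W]

/-- Time slices are open in `X`, so space derivatives are ordinary ones even at `t = 0`. -/
lemma hasFDerivAt_slice {I : Set ℝ} {S : Set X} (hS : IsOpen S) {h : ℝ × X → W}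
    {h' : ℝ × X →L[ℝ] W} {t : ℝ} {x : X} (hh : HasFDerivWithinAt h h' (I ×ˢ S) (t, x))
    (ht : t ∈ I) (hx : x ∈ S) :
    HasFDerivAt (fun y => h (t, y)) (h'.comp (ContinuousLinearMap.inr ℝ ℝ X)) x := by
  have h1 : HasFDerivAt (fun y : X => ((t, y) : ℝ × X)) (ContinuousLinearMap.inr ℝ ℝ X) x :=
    hasFDerivAt_prodMk_right t x
  refine (HasFDerivWithinAt.comp (t := I ×ˢ S) x hh (h1.hasFDerivWithinAt (s := S)) ?_).hasFDerivAt
    (hS.mem_nhds hx)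
  exact fun y hy => ⟨ht, hy⟩

lemma hasDerivWithinAt_slice {I : Set ℝ} {S : Set X} {h : ℝ × X → W}
    {h' : ℝ × X →L[ℝ] W} {t : ℝ} {x : X} (hh : HasFDerivWithinAt h h' (I ×ˢ S) (t, x))
    (hx : x ∈ S) :
    HasDerivWithinAt (fun s => h (s, x)) (h' (1, 0)) I t := by
  have h1 : HasDerivWithinAt (fun s : ℝ => ((s, x) : ℝ × X)) (1, 0) I t :=
    (hasDerivWithinAt_id _ _).prodMk (hasDerivWithinAt_const _ _ _)
  exact HasFDerivWithinAt.comp_hasDerivWithinAt (t := I ×ˢ S) t hh h1 (fun s hs => ⟨hs, hx⟩)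

lemma contDiffOn_fderivWithin_infty {D : Set X} {h : X → W} (hh : ContDiffOn ℝ ∞ h D)
    (hD : UniqueDiffOn ℝ D) : ContDiffOn ℝ ∞ (fderivWithin ℝ h D) D :=
  hh.fderivWithin hD (by simp)

lemma hasFDerivWithinAt_of_contDiffOn {D : Set X} {h : X → W} (hh : ContDiffOn ℝ ∞ h D) {z : X}
    (hz : z ∈ D) : HasFDerivWithinAt h (fderivWithin ℝ h D z) D z :=
  (hh.differentiableOn (by simp) z hz).hasFDerivWithinAt

lemma isSymmSndFDerivWithinAt_of_contDiffOn (hT : 0 < T) {S : Set X} (hS : IsOpen S)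
    {h : ℝ × X → W} (hh : ContDiffOn ℝ ∞ h (timeInterval T ×ˢ S)) {z : ℝ × X}
    (hz : z ∈ timeInterval T ×ˢ S) : IsSymmSndFDerivWithinAt ℝ h (timeInterval T ×ˢ S) z :=
  (hh z hz).isSymmSndFDerivWithinAt (by simpa using WithTop.coe_le_coe.2 (le_top : (2 : ℕ∞) ≤ ⊤)) (uniqueDiffOn_timeInterval_prod hT hS)
    (timeInterval_prod_subset_closure hT hS hz) hz

end TimeInterval

/-! ### Maps on `M` and their coordinate expressions -/

section Charts

variable {n : ℕ} {M : Type*} [TopologicalSpace M] [ChartedSpace (E n) M]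
  {T : EReal}

section Rep

variable {W : Type*}

/-- The expression of a time-dependent map on `M` in the chart around `p`. -/
def chartRep (f : ℝ → M → W) (p : M) (z : ℝ × E n) : W :=
  f z.1 ((extChartAt 𝓘(ℝ, E n) p).symm z.2)

lemma chartRep_mk (f : ℝ → M → W) (p : M) (t : ℝ) (x : E n) :
    chartRep f p (t, x) = localRep (f t) p x := rfl

lemma localRep_coord (f : M → W) (p : M) : localRep (n := n) f p (coord p) = f p := by
  simp [localRep, coord]

end Rep

variable {W : Type*} [NormedAddCommGroup W] [NormedSpace ℝ W]

lemma coord_mem (p : M) : (coord p : E n) ∈ (extChartAt 𝓘(ℝ, E n) p).target := mem_extChartAt_target p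

lemma symm_coord (p : M) : (extChartAt 𝓘(ℝ, E n) p).symm (coord p) = p := by
  simp [coord]

lemma isOpen_target (p : M) : IsOpen (extChartAt 𝓘(ℝ, E n) p).target := isOpen_extChartAt_target p

/-- The standard basis vectors of `ℝⁿ`. -/
abbrev bv (i : Fin n) : E n := EuclideanSpace.single i 1

/-- The part of `ℝ × M` lying over a set of coordinates of the chart around `p`. -/
def chartNhd (p : M) (B : Set (E n)) : Set (ℝ × M) :=
  univ ×ˢ ((extChartAt 𝓘(ℝ, E n) p).source ∩ (extChartAt 𝓘(ℝ, E n) p) ⁻¹' B)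

lemma isOpen_chartNhd (p : M) {B : Set (E n)} (hB : IsOpen B) : IsOpen (chartNhd p B) :=
  isOpen_univ.prod (isOpen_extChartAt_preimage' p hB)

lemma mdifferentiableAt_slice {f : ℝ → M → W}
    (hf : ContMDiffOn (𝓘(ℝ, ℝ).prod 𝓘(ℝ, E n)) 𝓘(ℝ, W) ∞ (uncurry f) (spacetime M T))
    {t : ℝ} (ht : t ∈ timeInterval T) (q : M) : MDifferentiableAt 𝓘(ℝ, E n) 𝓘(ℝ, W) (f t) q := by
  have h1 : ContMDiff 𝓘(ℝ, E n) (𝓘(ℝ, ℝ).prod 𝓘(ℝ, E n)) ∞ (fun q : M => (t, q)) :=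
    contMDiff_const.prodMk contMDiff_id
  have h2 : ContMDiff 𝓘(ℝ, E n) 𝓘(ℝ, W) ∞ (f t) := by
    rw [← contMDiffOn_univ]
    exact hf.comp h1.contMDiffOn fun q _ => ⟨ht, mem_univ _⟩
  exact h2.mdifferentiableAt (by simp)

lemma mfderiv_eq_fderiv_localRep {f : M → W} {p : M}
    (hf : MDifferentiableAt 𝓘(ℝ, E n) 𝓘(ℝ, W) f p) (v : E n) :
    mfderiv 𝓘(ℝ, E n) 𝓘(ℝ, W) f p v = fderiv ℝ (localRep f p) (coord p) v := by
  rw [hf.mfderiv]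
  simp only [modelWithCornersSelf_coe, range_id, fderivWithin_univ]
  rfl

section Smooth

variable [IsManifold 𝓘(ℝ, E n) ∞ M]

lemma contDiffOn_chartRep {f : ℝ → M → W}
    (hf : ContMDiffOn (𝓘(ℝ, ℝ).prod 𝓘(ℝ, E n)) 𝓘(ℝ, W) ∞ (uncurry f) (spacetime M T)) (p : M) :
    ContDiffOn ℝ ∞ (chartRep f p) (timeInterval T ×ˢ (extChartAt 𝓘(ℝ, E n) p).target) := by
  rw [← contMDiffOn_iff_contDiffOn, modelWithCornersSelf_prod, ← chartedSpaceSelf_prod]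
  have h1 : ContMDiffOn (𝓘(ℝ, ℝ).prod 𝓘(ℝ, E n)) (𝓘(ℝ, ℝ).prod 𝓘(ℝ, E n)) ∞
      (fun z : ℝ × E n => (z.1, (extChartAt 𝓘(ℝ, E n) p).symm z.2))
      (timeInterval T ×ˢ (extChartAt 𝓘(ℝ, E n) p).target) :=
    contMDiffOn_fst.prodMk ((contMDiffOn_extChartAt_symm p).comp contMDiffOn_snd fun z hz => hz.2)
  exact hf.comp h1 fun z hz => ⟨hz.1, mem_univ _⟩

lemma contMDiffOn_of_chart {f : ℝ → M → W} {p : M} {B : Set (E n)} {h : ℝ × E n → W}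
    (hh : ContDiffOn ℝ ∞ h (timeInterval T ×ˢ B))
    (hf : ∀ t ∈ timeInterval T, ∀ q ∈ (extChartAt 𝓘(ℝ, E n) p).source,
      extChartAt 𝓘(ℝ, E n) p q ∈ B → f t q = h (t, extChartAt 𝓘(ℝ, E n) p q)) :
    ContMDiffOn (𝓘(ℝ, ℝ).prod 𝓘(ℝ, E n)) 𝓘(ℝ, W) ∞ (uncurry f)
      (chartNhd p B ∩ spacetime M T) := by
  have hh' : ContMDiffOn (𝓘(ℝ, ℝ).prod 𝓘(ℝ, E n)) 𝓘(ℝ, W) ∞ h (timeInterval T ×ˢ B) := by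
    rw [← contMDiffOn_iff_contDiffOn, modelWithCornersSelf_prod, ← chartedSpaceSelf_prod] at hh
    exact hh
  have h1 : ContMDiffOn (𝓘(ℝ, ℝ).prod 𝓘(ℝ, E n)) (𝓘(ℝ, ℝ).prod 𝓘(ℝ, E n)) ∞
      (fun z : ℝ × M => (z.1, extChartAt 𝓘(ℝ, E n) p z.2)) (chartNhd p B ∩ spacetime M T) := by
    refine contMDiffOn_fst.prodMk (contMDiffOn_extChartAt.comp contMDiffOn_snd fun z hz => ?_)
    have := hz.1.2.1
    rwa [extChartAt_source] at this
  refine (hh'.comp h1 fun z hz => ⟨hz.2.1, hz.1.2.2⟩).congr fun z hz => ?_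
  exact hf z.1 hz.2.1 z.2 hz.1.2.1 hz.1.2.2

/-- The differential of the inverse of the chart around `p`. -/
def chartDiff (p : M) (x : E n) :
    E n →L[ℝ] TangentSpace 𝓘(ℝ, E n) ((extChartAt 𝓘(ℝ, E n) p).symm x) :=
  mfderiv 𝓘(ℝ, E n) 𝓘(ℝ, E n) (extChartAt 𝓘(ℝ, E n) p).symm x

lemma chartDiff_bijective (p : M) {x : E n} (hx : x ∈ (extChartAt 𝓘(ℝ, E n) p).target) :
    Bijective (chartDiff p x) := by
  have : IsManifold 𝓘(ℝ, E n) 1 M := IsManifold.of_le (n := ∞) (by simp)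
  have := isInvertible_mfderivWithin_extChartAt_symm (I := 𝓘(ℝ, E n)) hx
  rw [modelWithCornersSelf_coe, range_id, mfderivWithin_univ] at this
  exact this.bijective

lemma fderiv_localRep {f : M → W} {p : M} {x : E n}
    (hx : x ∈ (extChartAt 𝓘(ℝ, E n) p).target)
    (hf : MDifferentiableAt 𝓘(ℝ, E n) 𝓘(ℝ, W) f ((extChartAt 𝓘(ℝ, E n) p).symm x)) (v : E n) :
    fderiv ℝ (localRep f p) x v =
      mfderiv 𝓘(ℝ, E n) 𝓘(ℝ, W) f ((extChartAt 𝓘(ℝ, E n) p).symm x) (chartDiff p x v) := by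
  rw [← mfderiv_eq_fderiv, localRep]
  have h1 : MDifferentiableAt 𝓘(ℝ, E n) 𝓘(ℝ, E n) (extChartAt 𝓘(ℝ, E n) p).symm x :=
    ((contMDiffOn_extChartAt_symm (n := ∞) p).contMDiffAt
      ((isOpen_target p).mem_nhds hx)).mdifferentiableAt (by simp)
  exact mfderiv_comp_apply x hf h1 v

end Smooth
end Charts

/-! ### Laplacian, gradient and tangent plane of a single immersion -/

section Static

variable {n : ℕ} {M : Type*} [TopologicalSpace M] [ChartedSpace (E n) M]

/-- The coordinate frame `∂ᵢF` in the chart around `p`. -/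
def frameAt (F : M → V n) (p : M) (x : E n) (i : Fin n) : V n := pderiv i (localRep F p) x

/-- The second derivatives `∂ᵢ∂ⱼF` in the chart around `p`. -/
def hessAt (F : M → V n) (p : M) (x : E n) (i j : Fin n) : V n :=
  pderiv i (pderiv j (localRep F p)) x

lemma metric_eq_gramMat (F : M → V n) (p : M) (x : E n) :
    metric F p x = gramMat (frameAt F p x) := rfl

lemma pderiv_inner {f g : E n → V n} {x : E n} (hf : DifferentiableAt ℝ f x)
    (hg : DifferentiableAt ℝ g x) (i : Fin n) :
    pderiv i (fun y => (inner ℝ (f y) (g y) : ℝ)) x =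
      inner ℝ (f x) (pderiv i g x) + inner ℝ (pderiv i f x) (g x) := by
  rw [pderiv, (hf.hasFDerivAt.inner ℝ hg.hasFDerivAt).fderiv]
  simp [pderiv, fderivInnerCLM_apply]

/-- By the product rule, with the second derivatives of `F` symmetric, `∂ᵢgⱼₗ + ∂ⱼgᵢₗ - ∂ₗgᵢⱼ`
collapses to `2⟨∂ₗF, ∂ᵢ∂ⱼF⟩`. Christoffel terms are therefore pairings with the tangential part of
`∂ᵢ∂ⱼF`. -/
lemma christoffel_eq {F : M → V n} {p : M} {x : E n}
    (hd : ∀ j, DifferentiableAt ℝ (pderiv j (localRep F p)) x)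
    (hs : ∀ i j, hessAt F p x i j = hessAt F p x j i) (k i j : Fin n) :
    christoffel F p x k i j =
      ∑ l, (gramMat (frameAt F p x))⁻¹ k l * inner ℝ (frameAt F p x l) (hessAt F p x i j) := by
  have hm : ∀ i j l, pderiv l (fun y => metric F p y i j) x =
      inner ℝ (frameAt F p x i) (hessAt F p x l j) +
        inner ℝ (hessAt F p x l i) (frameAt F p x j) := fun i j l =>
    pderiv_inner (hd i) (hd j) l
  rw [christoffel, metric_eq_gramMat, Finset.mul_sum]
  refine Finset.sum_congr rfl fun l _ => ?_
  rw [hm, hm, hm, hs l j, hs l i, hs j i, real_inner_comm (frameAt F p x l) (hessAt F p x i j),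
    real_inner_comm (frameAt F p x j) (hessAt F p x i l)]
  ring

lemma laplacian_eq {F : M → V n} {p : M}
    (hd : ∀ j, DifferentiableAt ℝ (pderiv j (localRep F p)) (coord p : E n))
    (hs : ∀ i j, hessAt F p (coord p) i j = hessAt F p (coord p) j i) (f : M → ℝ) :
    laplacian F f p = ∑ i, ∑ j, (gramMat (frameAt F p (coord p)))⁻¹ i j *
      (pderiv i (pderiv j (localRep f p)) (coord p) -
        ∑ k, ∑ l, (gramMat (frameAt F p (coord p)))⁻¹ k l *
          inner ℝ (frameAt F p (coord p) l) (hessAt F p (coord p) i j) *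
            pderiv k (localRep f p) (coord p)) := by
  rw [laplacian, metric_eq_gramMat]
  refine Finset.sum_congr rfl fun i _ => Finset.sum_congr rfl fun j _ => ?_
  congr 2
  refine Finset.sum_congr rfl fun k _ => ?_
  rw [christoffel_eq hd hs, Finset.sum_mul]

lemma inner_tanComp_right (e : Fin n → V n) (c h : V n) :
    inner ℝ c (tanComp e h) =
      ∑ k, ∑ l, (gramMat e)⁻¹ k l * inner ℝ (e l) h * inner ℝ c (e k) := by
  simp [tanComp, inner_sum, real_inner_smul_right]

/-- The Laplacian of a function whose differential is `⟨c, dF⟩` at `p`. -/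
lemma laplacian_eq_of_pderiv_eq {F : M → V n} {p : M}
    (hd : ∀ j, DifferentiableAt ℝ (pderiv j (localRep F p)) (coord p : E n))
    (hs : ∀ i j, hessAt F p (coord p) i j = hessAt F p (coord p) j i) {f : M → ℝ} {c : V n}
    (hf : ∀ j, pderiv j (localRep f p) (coord p) = inner ℝ c (frameAt F p (coord p) j)) :
    laplacian F f p = ∑ i, ∑ j, (gramMat (frameAt F p (coord p)))⁻¹ i j *
      (pderiv i (pderiv j (localRep f p)) (coord p) -
        inner ℝ c (tanComp (frameAt F p (coord p)) (hessAt F p (coord p) i j))) := by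
  rw [laplacian_eq hd hs]
  simp only [hf, inner_tanComp_right]

lemma gradient_eq_of_pderiv_eq {F : M → V n} {p : M} {f : M → ℝ} {c : V n}
    (hf : ∀ j, pderiv j (localRep f p) (coord p) = inner ℝ c (frameAt F p (coord p) j)) :
    gradient F f p = tanComp (frameAt F p (coord p)) c := by
  rw [gradient, tanComp, metric_eq_gramMat]
  refine Finset.sum_congr rfl fun i _ => Finset.sum_congr rfl fun j _ => ?_
  rw [hf, real_inner_comm]
  rfl

/-- Recovers the differential from the gradient; needed for an arbitrary `β`, which is only known
through `∇β`. -/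
lemma pderiv_eq_of_gradient_eq {F : M → V n} {p : M} (he : IsLagFrame (frameAt F p (coord p)))
    {f : M → ℝ} {c : V n} (h : gradient F f p = tanComp (frameAt F p (coord p)) c) (j : Fin n) :
    pderiv j (localRep f p) (coord p) = inner ℝ c (frameAt F p (coord p) j) := by
  have h1 : inner ℝ (gradient F f p) (frameAt F p (coord p) j) =
      inner ℝ c (frameAt F p (coord p) j) := by
    rw [h, ← real_inner_comm, he.inner_tanComp, real_inner_comm]
  rw [← h1, gradient, metric_eq_gramMat]
  simp only [sum_inner, real_inner_smul_left]
  set e := frameAt F p (coord p)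
  have h2 : ∀ i, (inner ℝ (pderiv i (localRep F p) (coord p)) (e j) : ℝ) = gramMat e i j :=
    fun i => rfl
  simp only [h2]
  rw [Finset.sum_comm]
  have h3 : ∀ k, ∑ i, (gramMat e)⁻¹ i k * pderiv k (localRep f p) (coord p) * gramMat e i j =
      ((gramMat e)⁻¹ * gramMat e) k j * pderiv k (localRep f p) (coord p) := by
    intro k
    rw [Matrix.mul_apply, Finset.sum_mul]
    refine Finset.sum_congr rfl fun i _ => ?_
    rw [gramMat_inv_symm e i k]; ring
  simp only [h3, he.inv_mul, Matrix.one_apply]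
  simp

lemma tangentPlane_eq_span {F : M → V n} {p : M}
    (hF : MDifferentiableAt 𝓘(ℝ, E n) 𝓘(ℝ, V n) F p) :
    tangentPlane F p = Submodule.span ℝ (range (frameAt F p (coord p))) := by
  have h1 : tangentPlane F p = LinearMap.range (fderiv ℝ (localRep F p) (coord p : E n)).toLinearMap := by
    ext v
    exact exists_congr fun w : E n =>
      (mfderiv_eq_fderiv_localRep hF w).congr_left
  rw [h1, LinearMap.range_eq_map, ← (EuclideanSpace.basisFun (Fin n) ℝ).toBasis.span_eq,
    LinearMap.map_span, ← range_comp]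
  congr 2
  ext i : 1
  simp [frameAt, pderiv]

end Static

/-! ### Space-time derivatives in a chart -/

section Flow

variable {n : ℕ} {M : Type*} [TopologicalSpace M] [ChartedSpace (E n) M] {T : EReal}

/-- The coordinate domain of `[0, T) × M` given by the chart around `p`. -/
def dom (n : ℕ) {M : Type*} [TopologicalSpace M] [ChartedSpace (E n) M] (T : EReal) (p : M) :
    Set (ℝ × E n) :=
  timeInterval T ×ˢ (extChartAt 𝓘(ℝ, E n) p).target

lemma uniqueDiffOn_dom (hT : 0 < T) (p : M) : UniqueDiffOn ℝ (dom n T p) :=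
  uniqueDiffOn_timeInterval_prod hT (isOpen_target p)

lemma coord_mem_dom {t : ℝ} (ht : t ∈ timeInterval T) (p : M) : (t, coord p) ∈ dom n T p :=
  ⟨ht, coord_mem p⟩

variable {W : Type*} [NormedAddCommGroup W] [NormedSpace ℝ W]

/-- The differential in space and time of the coordinate expression of a map. -/
def stDiff (T : EReal) (f : ℝ → M → W) (p : M) (z : ℝ × E n) : ℝ × E n →L[ℝ] W :=
  fderivWithin ℝ (chartRep f p) (dom n T p) z

/-- The second differential in space and time of the coordinate expression of a map. -/
def stDiff2 (T : EReal) (f : ℝ → M → W) (p : M) (z : ℝ × E n) :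
    ℝ × E n →L[ℝ] ℝ × E n →L[ℝ] W :=
  fderivWithin ℝ (stDiff T f p) (dom n T p) z

/-- Smoothness of a time-dependent map on `[0, T) × M`. -/
abbrev SmoothFlow (n : ℕ) {M : Type*} [TopologicalSpace M] [ChartedSpace (E n) M]
    (T : EReal) (f : ℝ → M → W) : Prop :=
  ContMDiffOn (𝓘(ℝ, ℝ).prod 𝓘(ℝ, E n)) 𝓘(ℝ, W) ∞ (uncurry f) (spacetime M T)

variable [IsManifold 𝓘(ℝ, E n) ∞ M] {f : ℝ → M → W}

lemma SmoothFlow.hasFDerivWithinAt (hf : SmoothFlow n T f) {p : M} {z : ℝ × E n}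
    (hz : z ∈ dom n T p) :
    HasFDerivWithinAt (chartRep f p) (stDiff T f p z) (dom n T p) z :=
  hasFDerivWithinAt_of_contDiffOn (contDiffOn_chartRep hf p) hz

lemma SmoothFlow.contDiffOn_stDiff (hT : 0 < T) (hf : SmoothFlow n T f) (p : M) :
    ContDiffOn ℝ ∞ (stDiff T f p) (dom n T p) :=
  contDiffOn_fderivWithin_infty (contDiffOn_chartRep hf p) (uniqueDiffOn_dom hT p)

lemma SmoothFlow.hasFDerivWithinAt_stDiff (hT : 0 < T) (hf : SmoothFlow n T f) {p : M}
    {z : ℝ × E n} (hz : z ∈ dom n T p) :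
    HasFDerivWithinAt (stDiff T f p) (stDiff2 T f p z) (dom n T p) z :=
  hasFDerivWithinAt_of_contDiffOn (hf.contDiffOn_stDiff hT p) hz

lemma SmoothFlow.stDiff2_symm (hT : 0 < T) (hf : SmoothFlow n T f) {p : M}
    {z : ℝ × E n} (hz : z ∈ dom n T p) (u v : ℝ × E n) :
    stDiff2 T f p z u v = stDiff2 T f p z v u :=
  (isSymmSndFDerivWithinAt_of_contDiffOn hT (isOpen_target p) (contDiffOn_chartRep hf p) hz).eq u v

lemma SmoothFlow.hasFDerivAt_localRep (hf : SmoothFlow n T f) {p : M} {t : ℝ} {x : E n}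
    (hz : (t, x) ∈ dom n T p) :
    HasFDerivAt (localRep (f t) p)
      ((stDiff T f p (t, x)).comp (ContinuousLinearMap.inr ℝ ℝ (E n))) x :=
  hasFDerivAt_slice (isOpen_target p) (hf.hasFDerivWithinAt hz) hz.1 hz.2

lemma SmoothFlow.fderiv_localRep_eq (hf : SmoothFlow n T f) {p : M} {t : ℝ} {x : E n}
    (hz : (t, x) ∈ dom n T p) (v : E n) :
    fderiv ℝ (localRep (f t) p) x v = stDiff T f p (t, x) (0, v) := by
  rw [(hf.hasFDerivAt_localRep hz).fderiv]; simp

lemma SmoothFlow.pderiv_localRep (hf : SmoothFlow n T f) {p : M} {t : ℝ} {x : E n}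
    (hz : (t, x) ∈ dom n T p) (j : Fin n) :
    pderiv j (localRep (f t) p) x = stDiff T f p (t, x) (0, bv j) :=
  hf.fderiv_localRep_eq hz _

lemma SmoothFlow.hasFDerivWithinAt_stDiff_apply (hT : 0 < T) (hf : SmoothFlow n T f) {p : M}
    {z : ℝ × E n} (hz : z ∈ dom n T p) (v : ℝ × E n) :
    HasFDerivWithinAt (fun y => stDiff T f p y v) ((stDiff2 T f p z).flip v) (dom n T p) z := by
  have := (hf.hasFDerivWithinAt_stDiff hT hz).clm_apply (hasFDerivWithinAt_const v z _)
  simpa using this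

lemma SmoothFlow.hasFDerivAt_stDiff_slice (hT : 0 < T) (hf : SmoothFlow n T f) {p : M} {t : ℝ}
    {x : E n} (hz : (t, x) ∈ dom n T p) (v : ℝ × E n) :
    HasFDerivAt (fun y => stDiff T f p (t, y) v)
      (((stDiff2 T f p (t, x)).flip v).comp (ContinuousLinearMap.inr ℝ ℝ (E n))) x :=
  hasFDerivAt_slice (isOpen_target p) (hf.hasFDerivWithinAt_stDiff_apply hT hz v) hz.1 hz.2

lemma SmoothFlow.hasFDerivAt_pderiv (hT : 0 < T) (hf : SmoothFlow n T f) {p : M} {t : ℝ}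
    {x : E n} (hz : (t, x) ∈ dom n T p) (j : Fin n) :
    HasFDerivAt (pderiv j (localRep (f t) p))
      (((stDiff2 T f p (t, x)).flip (0, bv j)).comp (ContinuousLinearMap.inr ℝ ℝ (E n))) x := by
  refine (hf.hasFDerivAt_stDiff_slice hT hz (0, bv j)).congr_of_eventuallyEq ?_
  filter_upwards [(isOpen_target p).mem_nhds hz.2] with y hy
  exact hf.pderiv_localRep (show (t, y) ∈ dom n T p from ⟨hz.1, hy⟩) j

lemma SmoothFlow.pderiv_pderiv (hT : 0 < T) (hf : SmoothFlow n T f) {p : M} {t : ℝ}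
    {x : E n} (hz : (t, x) ∈ dom n T p) (i j : Fin n) :
    pderiv i (pderiv j (localRep (f t) p)) x = stDiff2 T f p (t, x) (0, bv i) (0, bv j) := by
  rw [pderiv, (hf.hasFDerivAt_pderiv hT hz j).fderiv]; simp

lemma SmoothFlow.hasDerivWithinAt (hf : SmoothFlow n T f) {p : M} {t : ℝ} {x : E n}
    (hz : (t, x) ∈ dom n T p) :
    HasDerivWithinAt (fun s => f s ((extChartAt 𝓘(ℝ, E n) p).symm x)) (stDiff T f p (t, x) (1, 0))
      (timeInterval T) t :=
  hasDerivWithinAt_slice (hf.hasFDerivWithinAt hz) hz.2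

lemma SmoothFlow.hasDerivWithinAt_coord (hf : SmoothFlow n T f) {t : ℝ}
    (ht : t ∈ timeInterval T) (p : M) :
    HasDerivWithinAt (fun s => f s p) (stDiff (n := n) T f p (t, coord p) (1, 0))
      (timeInterval T) t := by
  have := hf.hasDerivWithinAt (coord_mem_dom ht p)
  rwa [symm_coord] at this

end Flow

/-! ### Lagrangian mean curvature flow in coordinates -/

section MCF

variable {n : ℕ} {M : Type*} [TopologicalSpace M] [ChartedSpace (E n) M] {T : EReal}
  {F : ℝ → M → V n}

lemma IsLagrangianMCF.smoothFlow (hF : IsLagrangianMCF T F) : SmoothFlow n T F := hF.smooth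

lemma IsLagrangianMCF.tangentPlane_eq (hF : IsLagrangianMCF T F) {t : ℝ}
    (ht : t ∈ timeInterval T) (p : M) :
    tangentPlane (F t) p = Submodule.span ℝ (range (frameAt (F t) p (coord p))) :=
  tangentPlane_eq_span (mdifferentiableAt_slice hF.smooth ht p)

variable [IsManifold 𝓘(ℝ, E n) ∞ M]

/-- `meanCurvature` at a point is defined in the chart around that very point, while here the chart
is that of `p`; the flow equation at a fixed point of `M` links the two without transforming `H`. -/
lemma IsLagrangianMCF.stDiff_time (hT : 0 < T) (hF : IsLagrangianMCF T F) {p : M} {t : ℝ}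
    {x : E n} (hz : (t, x) ∈ dom n T p) :
    stDiff T F p (t, x) (1, 0) = meanCurvature (F t) ((extChartAt 𝓘(ℝ, E n) p).symm x) :=
  (uniqueDiffOn_timeInterval hT t hz.1).eq_deriv _ (hF.smoothFlow.hasDerivWithinAt hz)
    (hF.flow t hz.1 _)

lemma IsLagrangianMCF.fderiv_localRep_eq (hF : IsLagrangianMCF T F) {p : M} {t : ℝ}
    {x : E n} (hz : (t, x) ∈ dom n T p) (v : E n) :
    fderiv ℝ (localRep (F t) p) x v =
      differential (F t) ((extChartAt 𝓘(ℝ, E n) p).symm x) (chartDiff p x v) :=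
  fderiv_localRep hz.2 (mdifferentiableAt_slice hF.smooth hz.1 _) v

lemma IsLagrangianMCF.inner_fderiv_eq_zero (hF : IsLagrangianMCF T F) {p : M} {t : ℝ}
    {x : E n} (hz : (t, x) ∈ dom n T p) (v w : E n) :
    inner ℝ (J (stDiff T F p (t, x) (0, v))) (stDiff T F p (t, x) (0, w)) = 0 := by
  rw [← hF.smoothFlow.fderiv_localRep_eq hz, ← hF.smoothFlow.fderiv_localRep_eq hz,
    hF.fderiv_localRep_eq hz, hF.fderiv_localRep_eq hz, ← omega_eq_inner]
  exact hF.lagrangian t hz.1 _ _ _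

lemma IsLagrangianMCF.isLagFrame (hF : IsLagrangianMCF T F) {p : M} {t : ℝ}
    {x : E n} (hz : (t, x) ∈ dom n T p) : IsLagFrame (frameAt (F t) p x) where
  linearIndependent := by
    have hinj : Injective (fderiv ℝ (localRep (F t) p) x) := by
      intro v w h
      rw [hF.fderiv_localRep_eq hz, hF.fderiv_localRep_eq hz] at h
      exact (chartDiff_bijective p hz.2).1 (hF.immersion t hz.1 _ h)
    have h := (EuclideanSpace.basisFun (Fin n) ℝ).toBasis.linearIndependent.map'
      (fderiv ℝ (localRep (F t) p) x).toLinearMap (LinearMap.ker_eq_bot.2 hinj)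
    have h2 : frameAt (F t) p x = (fderiv ℝ (localRep (F t) p) x).toLinearMap ∘
        (EuclideanSpace.basisFun (Fin n) ℝ).toBasis := by
      ext i : 1
      simp [frameAt, pderiv]
    rw [h2]
    exact h
  lagrangian i j := by
    have h := hF.inner_fderiv_eq_zero hz (bv i) (bv j)
    rwa [← hF.smoothFlow.pderiv_localRep hz, ← hF.smoothFlow.pderiv_localRep hz] at h

lemma IsLagrangianMCF.hessAt_symm (hT : 0 < T) (hF : IsLagrangianMCF T F) {p : M} {t : ℝ}
    {x : E n} (hz : (t, x) ∈ dom n T p) (i j : Fin n) :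
    hessAt (F t) p x i j = hessAt (F t) p x j i := by
  rw [hessAt, hessAt, hF.smoothFlow.pderiv_pderiv hT hz, hF.smoothFlow.pderiv_pderiv hT hz,
    hF.smoothFlow.stDiff2_symm hT hz]

lemma IsLagrangianMCF.differentiableAt_pderiv (hT : 0 < T) (hF : IsLagrangianMCF T F) {p : M}
    {t : ℝ} {x : E n} (hz : (t, x) ∈ dom n T p) (j : Fin n) :
    DifferentiableAt ℝ (pderiv j (localRep (F t) p)) x :=
  (hF.smoothFlow.hasFDerivAt_pderiv hT hz j).differentiableAt

lemma IsLagrangianMCF.tangentialPart_eq (hF : IsLagrangianMCF T F) {t : ℝ}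
    (ht : t ∈ timeInterval T) (p : M) (v : V n) :
    tangentialPart (F t) p v = tanComp (frameAt (F t) p (coord p)) v := by
  rw [tangentialPart, ← (hF.isLagFrame (coord_mem_dom ht p)).starProjection_span]
  simp only [hF.tangentPlane_eq ht p]

lemma IsLagrangianMCF.normalPart_eq (hF : IsLagrangianMCF T F) {t : ℝ}
    (ht : t ∈ timeInterval T) (p : M) (v : V n) :
    normalPart (F t) p v = norComp (frameAt (F t) p (coord p)) v := by
  rw [normalPart, ← (hF.isLagFrame (coord_mem_dom ht p)).starProjection_orthogonal]
  simp only [hF.tangentPlane_eq ht p]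

lemma IsLagrangianMCF.meanCurvature_eq (hF : IsLagrangianMCF T F) {t : ℝ}
    (ht : t ∈ timeInterval T) (p : M) :
    meanCurvature (F t) p = ∑ i, ∑ j, (gramMat (frameAt (F t) p (coord p)))⁻¹ i j •
      norComp (frameAt (F t) p (coord p)) (hessAt (F t) p (coord p) i j) := by
  rw [meanCurvature, metric_eq_gramMat]
  simp only [hF.normalPart_eq ht p]
  rfl

lemma IsLagrangianMCF.inner_meanCurvature (hF : IsLagrangianMCF T F) {t : ℝ}
    (ht : t ∈ timeInterval T) (p : M) (i : Fin n) :
    inner ℝ (frameAt (F t) p (coord p) i) (meanCurvature (F t) p) = 0 := by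
  rw [hF.meanCurvature_eq ht]
  simp [inner_sum, real_inner_smul_right, (hF.isLagFrame (coord_mem_dom ht p)).inner_norComp]

end MCF

/-! ### Smooth logarithms on convex sets -/

section Logarithm

variable {X : Type*} [NormedAddCommGroup X] [NormedSpace ℝ X]

/-- A continuous function with values in a coset of a cyclic subgroup is constant on connected
sets. -/
lemma eq_of_mem_zmultiples {Y : Type*} [TopologicalSpace Y] {D : Set Y} (hD : IsPreconnected D)
    {g : Y → ℝ} (hg : ContinuousOn g D) {c : ℝ} (hc : ∀ z ∈ D, g z ∈ AddSubgroup.zmultiples c)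
    {z w : Y} (hz : z ∈ D) (hw : w ∈ D) : g z = g w :=
  hD.constant_of_mapsTo (T := (AddSubgroup.zmultiples c : Set ℝ)) ⟨inferInstanceAs (DiscreteTopology (AddSubgroup.zmultiples c))⟩ hg hc hz hw

lemma eq_of_sin_eq_zero {Y : Type*} [TopologicalSpace Y] {D : Set Y} (hD : IsPreconnected D)
    {g : Y → ℝ} (hg : ContinuousOn g D) (hc : ∀ z ∈ D, Real.sin (g z) = 0)
    {z w : Y} (hz : z ∈ D) (hw : w ∈ D) : g z = g w := by
  refine eq_of_mem_zmultiples hD hg (c := Real.pi) (fun z hz => ?_) hz hw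
  obtain ⟨k, hk⟩ := Real.sin_eq_zero_iff.1 (hc z hz)
  exact AddSubgroup.mem_zmultiples_iff.2 ⟨k, by rw [← hk]; simp⟩

lemma contDiffOn_infty_of_hasFDerivWithinAt {W : Type*} [NormedAddCommGroup W] [NormedSpace ℝ W]
    {D : Set X} (hD : UniqueDiffOn ℝ D) {f : X → W} {f' : X → X →L[ℝ] W}
    (hf : ∀ z ∈ D, HasFDerivWithinAt f (f' z) D z) (hf' : ContDiffOn ℝ ∞ f' D) :
    ContDiffOn ℝ ∞ f D := by
  rw [contDiffOn_infty_iff_fderivWithin hD]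
  refine ⟨fun z hz => (hf z hz).differentiableWithinAt, hf'.congr fun z hz => ?_⟩
  exact (hf z hz).fderivWithin (hD z hz)

/-- A nowhere vanishing smooth function on a convex set has a smooth logarithm. -/
lemma exists_smooth_log {D : Set X} (hD : UniqueDiffOn ℝ D) (hconv : Convex ℝ D)
    (hcl : D ⊆ closure (interior D)) {w : X → ℂ} (hw : ContDiffOn ℝ ∞ w D)
    (h0 : ∀ z ∈ D, w z ≠ 0) :
    ∃ L : X → ℂ, ContDiffOn ℝ ∞ L D ∧ (∀ z ∈ D, Complex.exp (L z) = w z) ∧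
      ∀ z ∈ D, HasFDerivWithinAt L ((w z)⁻¹ • fderivWithin ℝ w D z) D z := by
  have hdw : ContDiffOn ℝ ∞ (fderivWithin ℝ w D) D := contDiffOn_fderivWithin_infty hw hD
  set η : X → X →L[ℝ] ℂ := fun z => (w z)⁻¹ • fderivWithin ℝ w D z with hη
  have hwinv : ContDiffOn ℝ ∞ (fun z => (w z)⁻¹) D := hw.inv h0
  have hηs : ContDiffOn ℝ ∞ η D := hwinv.smul hdw
  have hηd : ∀ z ∈ D, HasFDerivWithinAt η ((w z)⁻¹ • fderivWithin ℝ (fderivWithin ℝ w D) D z +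
      (fderivWithin ℝ (fun z => (w z)⁻¹) D z).smulRight (fderivWithin ℝ w D z)) D z := fun z hz =>
    (hasFDerivWithinAt_of_contDiffOn hwinv hz).smul (hasFDerivWithinAt_of_contDiffOn hdw hz)
  have hinv : ∀ z ∈ D, ∀ v, fderivWithin ℝ (fun z => (w z)⁻¹) D z v =
      -(w z ^ 2)⁻¹ * fderivWithin ℝ w D z v := by
    intro z hz v
    have h1 : HasFDerivAt (fun y : ℂ => y⁻¹) _ (w z) :=
      (hasDerivAt_inv (h0 z hz)).hasFDerivAt.restrictScalars ℝ
    have h2 := h1.comp_hasFDerivWithinAt z (hasFDerivWithinAt_of_contDiffOn hw hz)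
    have h3 := h2.fderivWithin (hD z hz)
    have h4 : fderivWithin ℝ (fun z => (w z)⁻¹) D z = _ := h3
    rw [h4]
    simp [mul_comm]
  -- Poincaré lemma for `η = w⁻¹ dw`. Its derivative is `w⁻¹ d²w - w⁻² dw ⊗ dw`, and both terms are
  -- symmetric.
  obtain ⟨L, hL⟩ := hconv.exists_forall_hasFDerivWithinAt_of_hasFDerivWithinAt_symmetric hηd (by
    intro z hz u _ v _
    have hs : IsSymmSndFDerivWithinAt ℝ w D z := (hw z hz).isSymmSndFDerivWithinAt
      (by simpa using WithTop.coe_le_coe.2 (le_top : (2 : ℕ∞) ≤ ⊤)) hD (hcl hz) hz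
    have h1 := hs.eq u v
    simp only [_root_.add_apply, _root_.smul_apply,
      ContinuousLinearMap.smulRight_apply, h1, hinv z hz, smul_eq_mul]
    ring)
  rcases D.eq_empty_or_nonempty with rfl | ⟨z0, hz0⟩
  · exact ⟨fun _ => 0, contDiffOn_const, fun z hz => absurd hz (notMem_empty z),
      fun z hz => absurd hz (notMem_empty z)⟩
  -- Since `dL = w⁻¹ dw`, the function `w exp(-L)` is constant; a logarithm of this constant is then
  -- added to `L`.
  have hderiv : ∀ z ∈ D, HasFDerivWithinAt (fun z => w z * Complex.exp (-L z)) (0 : X →L[ℝ] ℂ) D z := by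
    intro z hz
    have h1 : HasFDerivWithinAt (fun z => Complex.exp (-L z)) _ D z := (hL z hz).neg.cexp
    have h2 : HasFDerivWithinAt (fun z => w z * Complex.exp (-L z)) _ D z :=
      (hasFDerivWithinAt_of_contDiffOn hw hz).mul h1
    refine h2.congr_fderiv ?_
    ext v
    simp only [_root_.zero_apply, _root_.add_apply, _root_.smul_apply, _root_.neg_apply,
      Pi.neg_apply, smul_eq_mul, hη]
    field_simp [h0 z hz]
    ring
  have hconst : ∀ z ∈ D, w z * Complex.exp (-L z) = w z0 * Complex.exp (-L z0) := by
    intro z hz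
    refine hconv.is_const_of_fderivWithin_eq_zero (𝕜 := ℝ)
      (f := fun z => w z * Complex.exp (-L z))
      (fun z hz => (hderiv z hz).differentiableWithinAt) (fun z hz => ?_) hz hz0
    exact (hderiv z hz).fderivWithin (hD z hz)
  have hc0 : w z0 * Complex.exp (-L z0) ≠ 0 := mul_ne_zero (h0 z0 hz0) (Complex.exp_ne_zero _)
  have hL' : ∀ z ∈ D, HasFDerivWithinAt
      (fun z => L z + Complex.log (w z0 * Complex.exp (-L z0))) (η z) D z :=
    fun z hz => (hL z hz).add_const _
  refine ⟨_, contDiffOn_infty_of_hasFDerivWithinAt hD hL' hηs, fun z hz => ?_, hL'⟩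
  rw [Complex.exp_add, Complex.exp_log hc0, ← hconst z hz, Complex.exp_neg]
  field_simp [Complex.exp_ne_zero]

end Logarithm

/-! ### Differentiating `Ω` along a moving frame -/

section OmegaDeriv

variable {n : ℕ}

/-- `Ω` as a continuous real multilinear map. -/
def OmegaCM (n : ℕ) : ContinuousMultilinearMap ℝ (fun _ : Fin n => V n) ℂ :=
  { (OmegaAlt n).toMultilinearMap.restrictScalars ℝ with
    cont := by
      have h : Continuous fun e : Fin n → V n => Omega e := by
        unfold Omega
        refine Continuous.matrix_det ?_
        refine continuous_matrix fun i j => ?_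
        exact (EuclideanSpace.proj (𝕜 := ℂ) i).continuous.comp (continuous_apply j)
      convert h using 1
      funext e
      exact OmegaAlt_apply e }

lemma OmegaCM_apply (e : Fin n → V n) : OmegaCM n e = Omega e := OmegaAlt_apply e

variable {X : Type*} [NormedAddCommGroup X] [NormedSpace ℝ X]

lemma contDiffOn_Omega {D : Set X} {e : X → Fin n → V n}
    (he : ∀ j, ContDiffOn ℝ ∞ (fun z => e z j) D) : ContDiffOn ℝ ∞ (fun z => Omega (e z)) D := by
  have h1 : ContDiffOn ℝ ∞ e D := contDiffOn_pi.2 he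
  have h2 := (OmegaCM n).contDiff (n := ∞) |>.comp_contDiffOn h1
  exact h2.congr fun z _ => (OmegaCM_apply _).symm

/-- Jacobi's formula for `Ω` along a moving Lagrangian frame. -/
lemma fderivWithin_Omega {D : Set X} (hD : UniqueDiffOn ℝ D) {e : X → Fin n → V n} {z : X}
    (hz : z ∈ D) {e' : Fin n → X →L[ℝ] V n}
    (he : ∀ j, HasFDerivWithinAt (fun z => e z j) (e' j) D z) (hL : IsLagFrame (e z)) (v : X) :
    (Omega (e z))⁻¹ * fderivWithin ℝ (fun z => Omega (e z)) D z v =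
      ∑ j, ∑ k, ((gramMat (e z))⁻¹ j k : ℂ) * inner ℂ (e z k) (e' j v) := by
  have h1 : HasFDerivWithinAt e (ContinuousLinearMap.pi e') D z := hasFDerivWithinAt_pi.2 he
  have h2 := ((OmegaCM n).hasFDerivAt (x := e z)).comp_hasFDerivWithinAt z h1
  have h3 : HasFDerivWithinAt (fun z => Omega (e z)) _ D z :=
    h2.congr (fun z _ => (OmegaCM_apply _).symm) (OmegaCM_apply _).symm
  rw [h3.fderivWithin (hD z hz), ContinuousLinearMap.comp_apply,
    ContinuousMultilinearMap.linearDeriv_apply]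
  simp only [OmegaCM_apply, ContinuousLinearMap.pi_apply]
  rw [hL.sum_Omega_update, inv_mul_cancel_left₀ hL.Omega_ne_zero]

end OmegaDeriv

/-! ### The Lagrangian angle: differential and existence for all times -/

section Angle

variable {n : ℕ} {M : Type*} [TopologicalSpace M] [ChartedSpace (E n) M] {T : EReal}
  {F : ℝ → M → V n}

/-- The function `Ω(∂₁F, …, ∂ₙF)` in the chart around `p`. -/
def omegaRep (T : EReal) (F : ℝ → M → V n) (p : M) (z : ℝ × E n) : ℂ :=
  Omega fun j => stDiff T F p z (0, bv j)

/-- Numbers on a common real line have arguments that agree modulo `π`. Working modulo `π` and not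
`2π` avoids tracking the orientation of charts; continuity then makes the difference of arguments
constant. -/
lemma sin_im_sub_im_eq_zero {r a : ℝ} {K L : ℂ} (hr : r ≠ 0)
    (h : (r : ℂ) * Complex.exp K = a * Complex.exp L) : Real.sin (K.im - L.im) = 0 := by
  have h1 := congrArg Complex.re h
  have h2 := congrArg Complex.im h
  simp only [Complex.re_ofReal_mul, Complex.im_ofReal_mul, Complex.exp_re, Complex.exp_im] at h1 h2
  have h3 : r * Real.exp K.re * Real.sin (K.im - L.im) = 0 := by
    rw [Real.sin_sub]
    linear_combination Real.cos L.im * h2 - Real.sin L.im * h1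
  exact (mul_eq_zero.1 h3).resolve_left (mul_ne_zero hr (Real.exp_ne_zero _))

lemma smoothFlow_of_local {W : Type*} [NormedAddCommGroup W] [NormedSpace ℝ W] {f : ℝ → M → W}
    (h : ∀ p : M, ∃ B : Set (E n), IsOpen B ∧ coord p ∈ B ∧
      ContMDiffOn (𝓘(ℝ, ℝ).prod 𝓘(ℝ, E n)) 𝓘(ℝ, W) ∞ (uncurry f)
        (chartNhd p B ∩ spacetime M T)) : SmoothFlow n T f := by
  rintro ⟨t, p⟩ hz
  obtain ⟨B, hB, hp, hf⟩ := h p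
  have hmem : (t, p) ∈ chartNhd p B := ⟨mem_univ _, mem_extChartAt_source p, hp⟩
  refine (hf (t, p) ⟨hmem, hz⟩).mono_of_mem_nhdsWithin ?_
  exact Filter.inter_mem (mem_nhdsWithin_of_mem_nhds ((isOpen_chartNhd p hB).mem_nhds hmem))
    self_mem_nhdsWithin

lemma smoothFlow_const {W : Type*} [NormedAddCommGroup W] [NormedSpace ℝ W] {f : M → W}
    (hf : ContMDiff 𝓘(ℝ, E n) 𝓘(ℝ, W) ∞ f) : SmoothFlow n T (fun _ => f) :=
  (hf.comp contMDiff_snd).contMDiffOn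

lemma IsLagrangianMCF.isLagFrame_basis (hF : IsLagrangianMCF T F) {t : ℝ}
    (ht : t ∈ timeInterval T) {q : M} (b : Module.Basis (Fin n) ℝ (TangentSpace 𝓘(ℝ, E n) q)) :
    IsLagFrame fun j => differential (F t) q (b j) where
  linearIndependent := b.linearIndependent.map' (differential (F t) q).toLinearMap
    (LinearMap.ker_eq_bot.2 (hF.immersion t ht q))
  lagrangian i j := by
    rw [← omega_eq_inner]
    exact hF.lagrangian t ht q _ _

variable [IsManifold 𝓘(ℝ, E n) ∞ M]

lemma IsLagrangianMCF.frameAt_eq (hF : IsLagrangianMCF T F) {p : M} {t : ℝ} {x : E n}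
    (hz : (t, x) ∈ dom n T p) :
    frameAt (F t) p x = fun j => stDiff T F p (t, x) (0, bv j) :=
  funext fun j => hF.smoothFlow.pderiv_localRep hz j

lemma IsLagrangianMCF.omegaRep_eq (hF : IsLagrangianMCF T F) {p : M} {t : ℝ} {x : E n}
    (hz : (t, x) ∈ dom n T p) : omegaRep T F p (t, x) = Omega (frameAt (F t) p x) := by
  rw [hF.frameAt_eq hz]; rfl

lemma IsLagrangianMCF.omegaRep_ne_zero (hF : IsLagrangianMCF T F) {p : M} {z : ℝ × E n}
    (hz : z ∈ dom n T p) : omegaRep T F p z ≠ 0 := by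
  rw [← Prod.mk.eta (p := z), hF.omegaRep_eq hz]
  exact (hF.isLagFrame hz).Omega_ne_zero

lemma IsLagrangianMCF.contDiffOn_omegaRep (hT : 0 < T) (hF : IsLagrangianMCF T F) (p : M) :
    ContDiffOn ℝ ∞ (omegaRep T F p) (dom n T p) :=
  contDiffOn_Omega fun _ => (hF.smoothFlow.contDiffOn_stDiff hT p).clm_apply contDiffOn_const

/-- The basis of a tangent space given by the chart around `p`. -/
def chartBasis (p : M) {x : E n} (hx : x ∈ (extChartAt 𝓘(ℝ, E n) p).target) :
    Module.Basis (Fin n) ℝ (TangentSpace 𝓘(ℝ, E n) ((extChartAt 𝓘(ℝ, E n) p).symm x)) :=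
  (EuclideanSpace.basisFun (Fin n) ℝ).toBasis.map
    (LinearEquiv.ofBijective (chartDiff p x).toLinearMap (chartDiff_bijective p hx))

lemma IsLagrangianMCF.differential_chartBasis (hF : IsLagrangianMCF T F) {p : M} {t : ℝ} {x : E n}
    (hz : (t, x) ∈ dom n T p) (j : Fin n) :
    differential (F t) _ (chartBasis p hz.2 j) = frameAt (F t) p x j := by
  have h := hF.fderiv_localRep_eq hz (bv j)
  rw [frameAt, pderiv, h]
  congr 1
  rw [chartBasis, Module.Basis.map_apply, OrthonormalBasis.coe_toBasis,
    EuclideanSpace.basisFun_apply]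
  rfl

/-- The factor `a` is the determinant of a change of basis of the tangent space of `M`: it is real
and independent of `t`, which is what makes arguments comparable along the flow. -/
lemma IsLagrangianMCF.Omega_basis (hF : IsLagrangianMCF T F) (p : M) {x : E n}
    (hx : x ∈ (extChartAt 𝓘(ℝ, E n) p).target) {q : M}
    (hq : (extChartAt 𝓘(ℝ, E n) p).symm x = q)
    (b : Module.Basis (Fin n) ℝ (TangentSpace 𝓘(ℝ, E n) q)) :
    ∃ a : ℝ, a ≠ 0 ∧ ∀ t ∈ timeInterval T,
      Omega (fun j => differential (F t) _ (b j)) = a * omegaRep T F p (t, x) := by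
  subst hq
  set c := chartBasis p hx
  refine ⟨(c.toMatrix b).det, ?_, fun t ht => ?_⟩
  · have : IsUnit (c.toMatrix b).det := by
      rw [← Module.Basis.det_apply]; exact c.isUnit_det b
    exact this.ne_zero
  · have hz : (t, x) ∈ dom n T p := ⟨ht, hx⟩
    have h1 : colMat (fun j => differential (F t) _ (b j)) =
        colMat (frameAt (F t) p x) * (c.toMatrix b).map Complex.ofRealHom := by
      ext i j
      have h2 : b j = ∑ k, c.toMatrix b k j • c k := by
        simp only [Module.Basis.toMatrix_apply]
        exact (c.sum_repr (b j)).symm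
      rw [colMat, Matrix.of_apply, h2, map_sum, Matrix.mul_apply]
      simp only [map_smul, c, hF.differential_chartBasis hz]
      simp [colMat, mul_comm]
    have h3 := congrArg Matrix.det h1
    rw [Matrix.det_mul, ← RingHom.mapMatrix_apply, ← RingHom.map_det, mul_comm] at h3
    rw [hF.omegaRep_eq hz]
    exact h3

lemma IsLagrangianMCF.exists_log (hT : 0 < T) (hF : IsLagrangianMCF T F) (p : M) :
    ∃ (r : ℝ) (L : ℝ × E n → ℂ), 0 < r ∧
      Metric.ball (coord p) r ⊆ (extChartAt 𝓘(ℝ, E n) p).target ∧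
      ContDiffOn ℝ ∞ L (timeInterval T ×ˢ Metric.ball (coord p) r) ∧
      (∀ z ∈ timeInterval T ×ˢ Metric.ball (coord p) r, Complex.exp (L z) = omegaRep T F p z) ∧
      ∀ z ∈ timeInterval T ×ˢ Metric.ball (coord p) r, HasFDerivWithinAt L
        ((omegaRep T F p z)⁻¹ • fderivWithin ℝ (omegaRep T F p)
          (timeInterval T ×ˢ Metric.ball (coord p) r) z)
        (timeInterval T ×ˢ Metric.ball (coord p) r) z := by
  obtain ⟨r, hr, hb⟩ := Metric.isOpen_iff.1 (isOpen_target p) (coord p : E n) (coord_mem p)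
  have hsub : timeInterval T ×ˢ Metric.ball (coord p) r ⊆ dom n T p := prod_mono subset_rfl hb
  obtain ⟨L, h1, h2, h3⟩ := exists_smooth_log
    (uniqueDiffOn_timeInterval_prod hT (Metric.isOpen_ball (x := coord p) (ε := r)))
    ((convex_timeInterval T).prod (convex_ball _ _))
    (timeInterval_prod_subset_closure hT Metric.isOpen_ball)
    ((hF.contDiffOn_omegaRep hT p).mono hsub) (fun z hz => hF.omegaRep_ne_zero (hsub hz))
  exact ⟨r, L, hr, hb, h1, h2, h3⟩

variable {o : ∀ p : M, Orientation ℝ (TangentSpace 𝓘(ℝ, E n) p) (Fin n)}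

/-- The chart basis may be negatively oriented, so `r` may be negative. -/
lemma IsLagrangianMCF.angle_eq (hn : 0 < n) (hF : IsLagrangianMCF T F) {p : M} {t : ℝ} {x : E n}
    (hz : (t, x) ∈ dom n T p) {θ : M → ℝ} (hθ : IsLagrangianAngle (F t) o θ) :
    ∃ r : ℝ, r ≠ 0 ∧ (r : ℂ) * Complex.exp (localRep θ p x * Complex.I) =
      omegaRep T F p (t, x) := by
  -- This is where `n ≥ 1` enters: a basis can be adjusted to a given orientation only if it is
  -- nonempty.
  have : Nonempty (Fin n) := ⟨⟨0, hn⟩⟩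
  set b := (chartBasis p hz.2).adjustToOrientation (o _)
  obtain ⟨a, ha, hb⟩ := hF.Omega_basis p hz.2 rfl b
  have h1 := hθ _ b (Module.Basis.orientation_adjustToOrientation _ _)
  rw [hb t hz.1] at h1
  set d : ℝ := √(Matrix.of fun i j : Fin n =>
          (inner ℝ (differential (F t) ((extChartAt 𝓘(ℝ, E n) p).symm x) (b i))
            (differential (F t) _ (b j)) : ℝ)).det
  have ha' : (a : ℂ) ≠ 0 := Complex.ofReal_ne_zero.2 ha
  refine ⟨d / a, div_ne_zero (fun h0 => ?_) ha, ?_⟩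
  · rw [h0, Complex.ofReal_zero, mul_zero] at h1
    exact mul_ne_zero ha' (hF.omegaRep_ne_zero hz) h1
  · push_cast
    rw [div_mul_eq_mul_div, div_eq_iff ha', mul_comm _ (a : ℂ), h1, mul_comm]
    rfl

lemma IsAngleFamily.sub_const (hn : 0 < n) (hF : IsLagrangianMCF T F) {θ : ℝ → M → ℝ}
    (hθ : IsAngleFamily T F o θ) {p : M} {r : ℝ} {L : ℝ × E n → ℂ}
    (hb : Metric.ball (coord p) r ⊆ (extChartAt 𝓘(ℝ, E n) p).target)
    (hL : ContinuousOn L (timeInterval T ×ˢ Metric.ball (coord p) r))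
    (hexp : ∀ z ∈ timeInterval T ×ˢ Metric.ball (coord p) r,
      Complex.exp (L z) = omegaRep T F p z) {z w : ℝ × E n}
    (hz : z ∈ timeInterval T ×ˢ Metric.ball (coord p) r)
    (hw : w ∈ timeInterval T ×ˢ Metric.ball (coord p) r) :
    chartRep θ p z - (L z).im = chartRep θ p w - (L w).im := by
  have hsub : timeInterval T ×ˢ Metric.ball (coord p) r ⊆ dom n T p := prod_mono subset_rfl hb
  refine eq_of_sin_eq_zero (g := fun z => chartRep θ p z - (L z).im)
    ((convex_timeInterval T).prod (convex_ball _ _)).isPreconnected ?_ ?_ hz hw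
  · exact ((contDiffOn_chartRep hθ.1 p).continuousOn.mono hsub).sub
      (Complex.continuous_im.comp_continuousOn hL)
  · rintro ⟨t, x⟩ hz
    obtain ⟨s, hs, h⟩ := hF.angle_eq hn (hsub hz) (hθ.2 t hz.1)
    have h1 := sin_im_sub_im_eq_zero (a := 1) (K := localRep (θ t) p x * Complex.I)
      (L := L (t, x)) hs
      (by rw [hexp _ hz, Complex.ofReal_one, one_mul, ← h])
    simpa [chartRep_mk] using h1

/-- The differential of the Lagrangian angle in terms of the second derivatives of `F`. -/
lemma IsAngleFamily.stDiff_eq (hn : 0 < n) (hT : 0 < T) (hF : IsLagrangianMCF T F)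
    {θ : ℝ → M → ℝ} (hθ : IsAngleFamily T F o θ) {t : ℝ} (ht : t ∈ timeInterval T) (p : M)
    (v : ℝ × E n) :
    stDiff T θ p (t, coord p) v =
      ∑ j, ∑ k, (gramMat (frameAt (F t) p (coord p)))⁻¹ j k *
        inner ℝ (J (frameAt (F t) p (coord p) k)) (stDiff2 T F p (t, coord p) v (0, bv j)) := by
  obtain ⟨r, L, hr, hb, hL, hexp, hd⟩ := hF.exists_log hT p
  set D := timeInterval T ×ˢ Metric.ball (coord p : E n) r
  have hsub : D ⊆ dom n T p := prod_mono subset_rfl hb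
  have hz : (t, coord p) ∈ D := ⟨ht, Metric.mem_ball_self hr⟩
  have hD : UniqueDiffOn ℝ D := uniqueDiffOn_timeInterval_prod hT Metric.isOpen_ball
  have h1 : HasFDerivWithinAt (chartRep θ p) (stDiff T θ p (t, coord p)) D (t, coord p) :=
    (SmoothFlow.hasFDerivWithinAt hθ.1 (hsub hz)).mono hsub
  have h2 : HasFDerivWithinAt (fun z => (L z).im) (Complex.imCLM.comp
      ((omegaRep T F p (t, coord p))⁻¹ • fderivWithin ℝ (omegaRep T F p) D (t, coord p)))
      D (t, coord p) :=
    Complex.imCLM.hasFDerivAt.comp_hasFDerivWithinAt _ (hd _ hz)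
  -- Locally `θ` is the imaginary part of a logarithm of `Ω(∂₁F, …, ∂ₙF)` plus a constant, so
  -- Jacobi's formula computes its differential.
  have h3 : HasFDerivWithinAt (chartRep θ p) (Complex.imCLM.comp
      ((omegaRep T F p (t, coord p))⁻¹ • fderivWithin ℝ (omegaRep T F p) D (t, coord p)))
      D (t, coord p) := by
    refine (h2.add_const (chartRep θ p (t, (coord p : E n)) - (L (t, coord p)).im)).congr
      (fun w hw => ?_) ?_
    · rw [← hθ.sub_const hn hF hb hL.continuousOn hexp hw hz]; ring
    · ring
  rw [(hD _ hz).eq h1 h3, ContinuousLinearMap.comp_apply, _root_.smul_apply, smul_eq_mul]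
  have h4 := fderivWithin_Omega hD (e := fun z j => stDiff T F p z (0, bv j)) hz
    (e' := fun j => (stDiff2 T F p (t, coord p)).flip (0, bv j))
    (fun j => (hF.smoothFlow.hasFDerivWithinAt_stDiff_apply hT (hsub hz) (0, bv j)).mono hsub)
    (by rw [← hF.frameAt_eq (hsub hz)]; exact hF.isLagFrame (hsub hz)) v
  rw [← hF.frameAt_eq (hsub hz)] at h4
  have h5 := congrArg Complex.im h4
  simp only [ContinuousLinearMap.flip_apply, Complex.im_sum, Complex.im_ofReal_mul,
    ← inner_J_eq_im] at h5
  rw [hF.frameAt_eq (hsub hz)] at h5 ⊢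
  exact h5

/-- The imaginary parts of the logarithms of `Ω(∂₁F, …, ∂ₙF)` in two charts differ by a
constant in time. -/
lemma IsLagrangianMCF.im_log_sub (hF : IsLagrangianMCF T F) {p q : M} {x : E n}
    (hx : x ∈ (extChartAt 𝓘(ℝ, E n) p).target) (hq : (extChartAt 𝓘(ℝ, E n) p).symm x = q)
    {K L : ℝ → ℂ} (hK : ContinuousOn K (timeInterval T)) (hL : ContinuousOn L (timeInterval T))
    (hKe : ∀ t ∈ timeInterval T, Complex.exp (K t) = omegaRep T F q (t, coord q))
    (hLe : ∀ t ∈ timeInterval T, Complex.exp (L t) = omegaRep T F p (t, x))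
    {s t : ℝ} (hs : s ∈ timeInterval T) (ht : t ∈ timeInterval T) :
    (K s).im - (L s).im = (K t).im - (L t).im := by
  refine eq_of_sin_eq_zero (g := fun t => (K t).im - (L t).im)
    (convex_timeInterval T).isPreconnected ?_ ?_ hs ht
  · exact (Complex.continuous_im.comp_continuousOn hK).sub
      (Complex.continuous_im.comp_continuousOn hL)
  · intro t ht
    -- Any fixed basis serves: it compares both charts with the same time-independent vectors, up to
    -- real factors.
    let b : Module.Basis (Fin n) ℝ (TangentSpace 𝓘(ℝ, E n) q) :=
      (EuclideanSpace.basisFun (Fin n) ℝ).toBasis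
    obtain ⟨a, ha, h1⟩ := hF.Omega_basis p hx hq b
    obtain ⟨a', ha', h2⟩ := hF.Omega_basis q (coord_mem q) (symm_coord q) b
    refine sin_im_sub_im_eq_zero (a := a) ha' ?_
    rw [hKe t ht, hLe t ht, ← h1 t ht, h2 t ht]

variable (o) in
/-- The Lagrangian angle extends smoothly from the initial time. -/
lemma IsLagrangianMCF.exists_angleFamily (hT : 0 < T) (hF : IsLagrangianMCF T F)
    (h0 : IsZeroMaslov (F 0) o) : ∃ θ : ℝ → M → ℝ, IsAngleFamily T F o θ := by
  obtain ⟨θ₀, hθ₀, hang⟩ := h0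
  choose r L hr hb hL hexp _ using fun p => hF.exists_log hT p
  have hzero := zero_mem_timeInterval hT
  have hsub : ∀ p : M, timeInterval T ×ˢ Metric.ball (coord p : E n) (r p) ⊆ dom n T p :=
    fun p => prod_mono subset_rfl (hb p)
  have hcont : ∀ p : M, ∀ x ∈ Metric.ball (coord p : E n) (r p),
      ContinuousOn (fun t => L p (t, x)) (timeInterval T) := fun p x hx =>
    (hL p).continuousOn.comp (by fun_prop) fun t ht => ⟨ht, hx⟩
  -- The change of argument is read off in the chart around each point separately. Smoothness
  -- follows because `im_log_sub` lets the logarithm of one fixed chart replace it nearby.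
  refine ⟨fun t q => θ₀ q + ((L q (t, coord q)).im - (L q (0, coord q)).im), ?_, ?_⟩
  · refine smoothFlow_of_local fun p => ⟨_, Metric.isOpen_ball, Metric.mem_ball_self (hr p), ?_⟩
    refine contMDiffOn_of_chart (h := fun z => chartRep (fun _ => θ₀) p z +
      ((L p z).im - (L p (0, z.2)).im)) ?_ ?_
    · refine ((contDiffOn_chartRep (smoothFlow_const hθ₀) p).mono (hsub p)).add
        (ContDiffOn.sub ?_ ?_)
      · exact Complex.imCLM.contDiff.comp_contDiffOn (hL p)
      · refine Complex.imCLM.contDiff.comp_contDiffOn ((hL p).comp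
          (contDiff_const.prodMk contDiff_snd).contDiffOn fun z hz => ⟨hzero, hz.2⟩)
    · intro t ht q hq hx
      have hsymm : (extChartAt 𝓘(ℝ, E n) p).symm (extChartAt 𝓘(ℝ, E n) p q) = q :=
        (extChartAt 𝓘(ℝ, E n) p).left_inv hq
      have h1 := hF.im_log_sub (hb p hx) hsymm (hcont q _ (Metric.mem_ball_self (hr q)))
        (hcont p _ hx) (fun t ht => hexp q _ ⟨ht, Metric.mem_ball_self (hr q)⟩)
        (fun t ht => hexp p _ ⟨ht, hx⟩) hzero ht
      simp only [chartRep, hsymm]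
      linarith
  · intro t ht q b hbo
    obtain ⟨a, ha, h1⟩ := hF.Omega_basis q (coord_mem q) (symm_coord q) b
    have h2 := hang q b hbo
    have hm : ∀ t ∈ timeInterval T,
        (t, coord q) ∈ timeInterval T ×ˢ Metric.ball (coord q : E n) (r q) :=
      fun t ht => ⟨ht, Metric.mem_ball_self (hr q)⟩
    -- The modulus of `Ω` on a Lagrangian frame is already the volume, so only the argument has to
    -- be followed; `h4` exhibits it.
    have h3 := (hF.isLagFrame_basis ht b).norm_Omega
    set d : ℝ := √(Matrix.of fun i j : Fin n =>
      (inner ℝ (differential (F 0) q (b i)) (differential (F 0) q (b j)) : ℝ)).det with hd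
    have hd0 : 0 ≤ d := Real.sqrt_nonneg _
    rw [h1 0 hzero, ← hexp q _ (hm 0 hzero)] at h2
    have h4 : Omega (fun j => differential (F t) q (b j)) =
        Complex.exp ((θ₀ q + ((L q (t, coord q)).im - (L q (0, coord q)).im) : ℝ) * Complex.I) *
          (d * Real.exp ((L q (t, coord q)).re - (L q (0, coord q)).re) : ℝ) := by
      rw [h1 t ht, ← hexp q _ (hm t ht)]
      have h5 : L q (t, coord q) = L q (0, coord q) + ((((L q (t, coord q)).re -
          (L q (0, coord q)).re : ℝ) : ℂ) + (((L q (t, coord q)).im -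
          (L q (0, coord q)).im : ℝ) : ℂ) * Complex.I) := by
        apply Complex.ext <;> simp
      conv_lhs => rw [h5, Complex.exp_add, ← mul_assoc, h2, Complex.exp_add]
      push_cast
      rw [add_mul, Complex.exp_add]
      ring
    rw [h4, norm_mul, Complex.norm_exp_ofReal_mul_I, one_mul, Complex.norm_real,
      Real.norm_of_nonneg (mul_nonneg hd0 (Real.exp_pos _).le)] at h3
    rw [h4, h3]
    rfl

end Angle

/-! ### `H = J∇θ` and the heat equation for the angle -/

section HeatEquation

variable {n : ℕ}

lemma inner_J_left (v w : V n) : inner ℝ (J v) w = - inner ℝ v (J w) := by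
  rw [inner_J_right, neg_neg]

lemma J_J (v : V n) : J (J v) = -v := by
  rw [J, J, smul_smul, Complex.I_mul_I, neg_one_smul]

lemma J_add (v w : V n) : J (v + w) = J v + J w := smul_add _ _ _

lemma inner_J_self (v : V n) : inner ℝ (J v) v = 0 := by
  have h := inner_J_left v v
  rw [real_inner_comm] at h
  linarith [real_inner_comm v (J v)]

/-- `J` maps the span of `J e` back to the tangent plane, to which `X` is orthogonal. -/
lemma inner_J_norComp_eq_zero {e : Fin n → V n} {X : V n} (hX : ∀ i, inner ℝ (e i) X = 0)
    (v : V n) : inner ℝ (J (norComp e v)) X = 0 := by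
  rw [← JL_apply, norComp]
  simp [map_sum, sum_inner, real_inner_smul_left, J_J, hX]

variable {M : Type*} [TopologicalSpace M] [ChartedSpace (E n) M] {T : EReal}
  {F : ℝ → M → V n} [IsManifold 𝓘(ℝ, E n) ∞ M]
  {o : ∀ p : M, Orientation ℝ (TangentSpace 𝓘(ℝ, E n) p) (Fin n)}

lemma SmoothFlow.hessAt_eq (hT : 0 < T) (hF : SmoothFlow n T F) {p : M} {t : ℝ} {x : E n}
    (hz : (t, x) ∈ dom n T p) (i j : Fin n) :
    hessAt (F t) p x i j = stDiff2 T F p (t, x) (0, bv i) (0, bv j) :=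
  hF.pderiv_pderiv hT hz i j

/-- The cubic form `⟨J ∂ᵢF, ∂ⱼ∂ₖF⟩` of a Lagrangian immersion is symmetric. -/
lemma IsLagrangianMCF.cubic_symm (hT : 0 < T) (hF : IsLagrangianMCF T F) {p : M} {t : ℝ} {x : E n}
    (hz : (t, x) ∈ dom n T p) (i j k : Fin n) :
    inner ℝ (J (frameAt (F t) p x i)) (hessAt (F t) p x j k) =
      inner ℝ (J (frameAt (F t) p x k)) (hessAt (F t) p x i j) := by
  have h1 := hF.smoothFlow.hasFDerivAt_pderiv hT hz
  have h2 : HasFDerivAt (fun y => (inner ℝ (JL n (pderiv i (localRep (F t) p) y))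
      (pderiv k (localRep (F t) p) y) : ℝ)) _ x :=
    ((JL n).hasFDerivAt.comp x (h1 i)).inner ℝ (h1 k)
  -- The Lagrangian condition says that this function vanishes near `x`; its derivative in direction
  -- `j`, combined with the symmetry of second derivatives, is the claim.
  have h3 : HasFDerivAt (fun y => (inner ℝ (JL n (pderiv i (localRep (F t) p) y))
      (pderiv k (localRep (F t) p) y) : ℝ)) (0 : E n →L[ℝ] ℝ) x := by
    refine (hasFDerivAt_const (0 : ℝ) x).congr_of_eventuallyEq ?_
    filter_upwards [(isOpen_target p).mem_nhds hz.2] with y hy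
    exact (hF.isLagFrame (show (t, y) ∈ dom n T p from ⟨hz.1, hy⟩)).lagrangian i k
  have h4 := congrArg (fun A : E n →L[ℝ] ℝ => A (bv j)) (h2.unique h3)
  simp [fderivInnerCLM_apply] at h4
  rw [hF.smoothFlow.hessAt_eq hT hz, hF.hessAt_symm hT hz i j, hF.smoothFlow.hessAt_eq hT hz]
  rw [inner_J_left _ (pderiv k _ _)] at h4
  rw [frameAt, frameAt]
  rw [real_inner_comm (J (pderiv k (localRep (F t) p) x))] at h4
  linarith

/-- `⟨J ∂ᵢF, H⟩ = ∂ᵢθ`. -/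
lemma IsAngleFamily.inner_J_meanCurvature (hn : 0 < n) (hT : 0 < T) (hF : IsLagrangianMCF T F)
    {θ : ℝ → M → ℝ} (hθ : IsAngleFamily T F o θ) {t : ℝ} (ht : t ∈ timeInterval T) (p : M)
    (i : Fin n) :
    inner ℝ (J (frameAt (F t) p (coord p) i)) (meanCurvature (F t) p) =
      stDiff T θ p (t, coord p) (0, bv i) := by
  have hz := coord_mem_dom (n := n) ht p
  have he := hF.isLagFrame hz
  rw [hθ.stDiff_eq hn hT hF ht, hF.meanCurvature_eq ht]
  simp only [inner_sum, real_inner_smul_right]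
  refine Finset.sum_congr rfl fun j _ => Finset.sum_congr rfl fun k _ => ?_
  congr 1
  -- Symmetry of the cubic form moves the free index `i` onto `J∂ᵢF`. There only the normal part of
  -- `∂ⱼ∂ₖF` counts, and its trace is `H`.
  rw [← hF.smoothFlow.hessAt_eq hT hz, ← hF.cubic_symm hT hz i j k]
  conv_rhs => rw [he.expansion (hessAt _ _ _ _ _), inner_add_right]
  have : inner ℝ (J (frameAt (F t) p (coord p) i))
      (tanComp (frameAt (F t) p (coord p)) (hessAt (F t) p (coord p) j k)) = 0 := by
    rw [inner_tanComp_right]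
    simp [he.lagrangian]
  rw [this, zero_add]

lemma clm_ext_bv {A B : E n →L[ℝ] ℝ} (h : ∀ i, A (bv i) = B (bv i)) : A = B := by
  have : A.toLinearMap = B.toLinearMap := by
    refine (EuclideanSpace.basisFun (Fin n) ℝ).toBasis.ext fun i => ?_
    simpa using h i
  ext v
  exact LinearMap.congr_fun this v

lemma IsAngleFamily.inner_J_meanCurvature_apply (hn : 0 < n) (hT : 0 < T)
    (hF : IsLagrangianMCF T F) {θ : ℝ → M → ℝ} (hθ : IsAngleFamily T F o θ) {t : ℝ}
    (ht : t ∈ timeInterval T) (p : M) (v : E n) :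
    inner ℝ (J (stDiff T F p (t, coord p) (0, v))) (meanCurvature (F t) p) =
      stDiff T θ p (t, coord p) (0, v) := by
  have h : ((innerSL ℝ (meanCurvature (F t) p)).comp (JL n)).comp
      ((stDiff T F p (t, coord p)).comp (ContinuousLinearMap.inr ℝ ℝ (E n))) =
      (stDiff T θ p (t, coord p)).comp (ContinuousLinearMap.inr ℝ ℝ (E n)) := by
    refine clm_ext_bv fun i => ?_
    have := hθ.inner_J_meanCurvature hn hT hF ht p i
    rw [hF.frameAt_eq (coord_mem_dom ht p)] at this
    simpa [real_inner_comm] using this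
  have h2 := congrArg (fun A : E n →L[ℝ] ℝ => A v) h
  simpa [real_inner_comm] using h2

/-- `⟨J ∂ᵥF, ∂ₜF⟩ = ∂ᵥθ` in any chart. -/
lemma IsAngleFamily.inner_J_stDiff (hn : 0 < n) (hT : 0 < T)
    (hF : IsLagrangianMCF T F) {θ : ℝ → M → ℝ} (hθ : IsAngleFamily T F o θ) {p : M}
    {z : ℝ × E n} (hz : z ∈ dom n T p) (v : E n) :
    inner ℝ (J (stDiff T F p z (0, v))) (stDiff T F p z (1, 0)) = stDiff T θ p z (0, v) := by
  obtain ⟨t, x⟩ := z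
  set q := (extChartAt 𝓘(ℝ, E n) p).symm x with hq
  -- The identity is known at the centre of each chart, so both sides are moved to the chart around
  -- `q`.
  have key : ∀ {W : Type} [NormedAddCommGroup W] [NormedSpace ℝ W] {f : ℝ → M → W},
      SmoothFlow n T f →
      stDiff T f p (t, x) (0, v) = stDiff T f q (t, coord q) (0, chartDiff p x v) := by
    intro W _ _ f hf
    have hd := mdifferentiableAt_slice hf hz.1 q
    rw [← hf.fderiv_localRep_eq hz, fderiv_localRep hz.2 hd]
    exact (mfderiv_eq_fderiv_localRep hd _).trans
      (hf.fderiv_localRep_eq (coord_mem_dom hz.1 q) _)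
  rw [key hF.smoothFlow, key hθ.1, hF.stDiff_time hT hz]
  exact hθ.inner_J_meanCurvature_apply hn hT hF hz.1 q _

lemma pderiv_inner_J {f g : E n → V n} {f' g' : E n →L[ℝ] V n} {x : E n}
    (hf : HasFDerivAt f f' x) (hg : HasFDerivAt g g' x) (i : Fin n) :
    pderiv i (fun y => (inner ℝ (J (f y)) (g y) : ℝ)) x =
      inner ℝ (J (f x)) (g' (bv i)) + inner ℝ (J (f' (bv i))) (g x) := by
  have h : HasFDerivAt (fun y => (inner ℝ (J (f y)) (g y) : ℝ)) _ x :=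
    ((JL n).hasFDerivAt.comp x hf).inner ℝ hg
  rw [pderiv, h.fderiv]
  simp [fderivInnerCLM_apply]

/-- The Lagrangian angle satisfies the heat equation. -/
lemma IsAngleFamily.heat (hn : 0 < n) (hT : 0 < T)
    (hF : IsLagrangianMCF T F) {θ : ℝ → M → ℝ} (hθ : IsAngleFamily T F o θ) {t : ℝ}
    (ht : t ∈ timeInterval T) (p : M) :
    HasDerivWithinAt (fun s => θ s p) (laplacian (F t) (θ t) p) (timeInterval T) t := by
  have hz := coord_mem_dom (n := n) ht p
  have he := hF.isLagFrame hz
  have hθ' : SmoothFlow n T θ := hθ.1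
  have h0 := hθ'.hasDerivWithinAt_coord ht p
  suffices h : laplacian (F t) (θ t) p = stDiff T θ p (t, (coord p : E n)) (1, 0) by
    rw [h]; exact h0
  set X := stDiff T F p (t, (coord p : E n)) (1, 0) with hX
  have hXH : X = meanCurvature (F t) p := by rw [hX, hF.stDiff_time hT hz, symm_coord]
  have hXn : ∀ i, inner ℝ (frameAt (F t) p (coord p) i) X = 0 := fun i => by
    rw [hXH]; exact hF.inner_meanCurvature ht p i
  have h1 : ∀ j, pderiv j (localRep (θ t) p) (coord p) =
      inner ℝ (-J X) (frameAt (F t) p (coord p) j) := by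
    intro j
    rw [hθ'.pderiv_localRep hz, ← hθ.inner_J_stDiff hn hT hF hz, hF.frameAt_eq hz, ← hX,
      inner_neg_left, inner_J_left X, neg_neg, real_inner_comm]
  rw [laplacian_eq_of_pderiv_eq (hF.differentiableAt_pderiv hT hz) (hF.hessAt_symm hT hz) h1,
    hθ.stDiff_eq hn hT hF ht]
  refine Finset.sum_congr rfl fun i _ => Finset.sum_congr rfl fun j _ => ?_
  congr 1
  -- Differentiating `∂ⱼθ = ⟨J∂ⱼF, ∂ₜF⟩` gives `⟨J∂ⱼF, ∂ᵢ∂ₜF⟩`, whose trace is `dθ/dt`, plus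
  -- `⟨J∂ᵢ∂ⱼF, ∂ₜF⟩`, which the Christoffel term cancels because `∂ₜF` is normal.
  have h2 : pderiv i (pderiv j (localRep (θ t) p)) (coord p) = pderiv i (fun y =>
      inner ℝ (J (stDiff T F p (t, y) (0, bv j))) (stDiff T F p (t, y) (1, 0))) (coord p) := by
    have : pderiv j (localRep (θ t) p) =ᶠ[𝓝 (coord p)] (fun y =>
      inner ℝ (J (stDiff T F p (t, y) (0, bv j))) (stDiff T F p (t, y) (1, 0))) := by
      filter_upwards [(isOpen_target p).mem_nhds hz.2] with y hy
      have hy' : (t, y) ∈ dom n T p := ⟨ht, hy⟩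
      rw [hθ'.pderiv_localRep hy', ← hθ.inner_J_stDiff hn hT hF hy']
    rw [pderiv, pderiv, this.fderiv_eq]
  rw [h2, pderiv_inner_J (hF.smoothFlow.hasFDerivAt_stDiff_slice hT hz _)
    (hF.smoothFlow.hasFDerivAt_stDiff_slice hT hz _)]
  simp only [ContinuousLinearMap.comp_apply, ContinuousLinearMap.inr_apply,
    ContinuousLinearMap.flip_apply]
  have h4 : frameAt (F t) p (coord p) j = stDiff T F p (t, coord p) (0, bv j) :=
    congrFun (hF.frameAt_eq hz) j
  rw [← hX, ← h4, ← hF.smoothFlow.hessAt_eq hT hz, hF.smoothFlow.stDiff2_symm hT hz (1, 0)]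
  have h3 : inner ℝ (J (hessAt (F t) p (coord p) i j)) X =
      inner ℝ (J (tanComp (frameAt (F t) p (coord p)) (hessAt (F t) p (coord p) i j))) X := by
    conv_lhs => rw [he.expansion (hessAt _ _ _ _ _), J_add, inner_add_left,
      inner_J_norComp_eq_zero hXn, add_zero]
  rw [h3, inner_neg_left, inner_J_left X, neg_neg, real_inner_comm X]
  ring

end HeatEquation

/-! ### The closed 1-form `⟨JF, dF⟩ - 2θ dt` -/

section Liouville

variable {n : ℕ} {M : Type*} [TopologicalSpace M] [ChartedSpace (E n) M] {T : EReal}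
  {F : ℝ → M → V n}

/-- The 1-form `⟨J F, dF⟩ - 2 θ dt` in the chart around `p`. -/
def liouvilleForm (T : EReal) (F : ℝ → M → V n) (θ : ℝ → M → ℝ) (p : M) (z : ℝ × E n) :
    ℝ × E n →L[ℝ] ℝ :=
  (innerSL ℝ (JL n (chartRep F p z))).comp (stDiff T F p z) -
    (2 * chartRep θ p z) • ContinuousLinearMap.fst ℝ ℝ (E n)

lemma liouvilleForm_apply (T : EReal) (F : ℝ → M → V n) (θ : ℝ → M → ℝ) (p : M)
    (z v : ℝ × E n) : liouvilleForm T F θ p z v =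
      inner ℝ (J (chartRep F p z)) (stDiff T F p z v) - 2 * chartRep θ p z * v.1 := by
  simp [liouvilleForm]

variable [IsManifold 𝓘(ℝ, E n) ∞ M]
  {o : ∀ p : M, Orientation ℝ (TangentSpace 𝓘(ℝ, E n) p) (Fin n)}

lemma IsLagrangianMCF.inner_meanCurvature_eq_sum (hF : IsLagrangianMCF T F) {t : ℝ}
    (ht : t ∈ timeInterval T) (p : M) (c : V n) :
    inner ℝ c (meanCurvature (F t) p) =
      ∑ i, ∑ j, (gramMat (frameAt (F t) p (coord p)))⁻¹ i j *
        inner ℝ c (norComp (frameAt (F t) p (coord p)) (hessAt (F t) p (coord p) i j)) := by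
  rw [hF.meanCurvature_eq ht]
  simp [inner_sum, real_inner_smul_right]

/-- The Laplacian of a primitive of the Liouville form. -/
lemma IsLagrangianMCF.laplacian_primitive (hT : 0 < T) (hF : IsLagrangianMCF T F) {t : ℝ}
    (ht : t ∈ timeInterval T) {p : M} {f : M → ℝ}
    (hf : ∀ j, ∀ᶠ y in 𝓝 (coord p : E n), pderiv j (localRep f p) y =
      inner ℝ (J (localRep (F t) p y)) (pderiv j (localRep (F t) p) y)) :
    laplacian (F t) f p = inner ℝ (J (F t p)) (meanCurvature (F t) p) := by
  have hz := coord_mem_dom (n := n) ht p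
  have he := hF.isLagFrame hz
  have h1 : ∀ j, pderiv j (localRep f p) (coord p) =
      inner ℝ (J (F t p)) (frameAt (F t) p (coord p) j) := by
    intro j
    rw [(hf j).self_of_nhds, localRep_coord]; rfl
  rw [laplacian_eq_of_pderiv_eq (hF.differentiableAt_pderiv hT hz) (hF.hessAt_symm hT hz) h1,
    hF.inner_meanCurvature_eq_sum ht]
  refine Finset.sum_congr rfl fun i _ => Finset.sum_congr rfl fun j _ => ?_
  congr 1
  have h2 : pderiv i (pderiv j (localRep f p)) (coord p) = pderiv i (fun y =>
      inner ℝ (J (localRep (F t) p y)) (pderiv j (localRep (F t) p) y)) (coord p) := by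
    have : pderiv j (localRep f p) =ᶠ[𝓝 (coord p)] _ := hf j
    rw [pderiv, pderiv, this.fderiv_eq]
  rw [h2, pderiv_inner_J (hF.smoothFlow.hasFDerivAt_localRep hz)
    (hF.smoothFlow.hasFDerivAt_pderiv hT hz j)]
  simp only [ContinuousLinearMap.comp_apply, ContinuousLinearMap.inr_apply,
    ContinuousLinearMap.flip_apply]
  rw [← hF.smoothFlow.hessAt_eq hT hz, ← hF.smoothFlow.pderiv_localRep hz, localRep_coord]
  -- The Lagrangian condition leaves `⟨JF, ∂ᵢ∂ⱼF⟩` as the second derivative; the Christoffel term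
  -- removes its tangential part, and the trace of the rest is `⟨JF, H⟩`.
  have h3 : inner ℝ (J (pderiv i (localRep (F t) p) (coord p)))
      (pderiv j (localRep (F t) p) (coord p)) = 0 := he.lagrangian i j
  rw [h3, add_zero]
  conv_lhs => rw [he.expansion (hessAt (F t) p (coord p) i j), inner_add_right]
  rw [← he.expansion, add_sub_cancel_left]

lemma contDiffOn_liouvilleForm (hT : 0 < T) (hF : SmoothFlow n T F) {θ : ℝ → M → ℝ}
    (hθ : SmoothFlow n T θ) (p : M) : ContDiffOn ℝ ∞ (liouvilleForm T F θ p) (dom n T p) := by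
  have h2 : ContDiffOn ℝ ∞ (fun z => 2 * chartRep θ p z) (dom n T p) :=
    contDiffOn_const.mul (contDiffOn_chartRep hθ p)
  refine ContDiffOn.sub (ContDiffOn.clm_comp ?_ (hF.contDiffOn_stDiff hT p))
    (h2.smul contDiffOn_const)
  exact ((innerSL ℝ).contDiff.comp (JL n).contDiff).comp_contDiffOn (contDiffOn_chartRep hF p)

/-- The exterior derivative is `2F*ω - 2dθ ∧ dt`. It vanishes because the slices are Lagrangian and
`⟨J∂ᵥF, ∂ₜF⟩ = ∂ᵥθ`; this is why the correction is exactly `-2θ dt`. -/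
lemma liouvilleForm_closed (hn : 0 < n) (hT : 0 < T) (hF : IsLagrangianMCF T F) {θ : ℝ → M → ℝ}
    (hθ : IsAngleFamily T F o θ) {p : M} {D : Set (ℝ × E n)} (hD : UniqueDiffOn ℝ D)
    (hsub : D ⊆ dom n T p) {z : ℝ × E n} (hz : z ∈ D) (u v : ℝ × E n) :
    fderivWithin ℝ (liouvilleForm T F θ p) D z u v =
      fderivWithin ℝ (liouvilleForm T F θ p) D z v u := by
  have hz' := hsub hz
  have hθ' : SmoothFlow n T θ := hθ.1
  have key : ∀ u v, fderivWithin ℝ (liouvilleForm T F θ p) D z u v =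
      inner ℝ (J (stDiff T F p z u)) (stDiff T F p z v) +
        inner ℝ (J (chartRep F p z)) (stDiff2 T F p z u v) - 2 * stDiff T θ p z u * v.1 := by
    intro u v
    have hd : HasFDerivWithinAt (liouvilleForm T F θ p)
        (fderivWithin ℝ (liouvilleForm T F θ p) D z) D z :=
      hasFDerivWithinAt_of_contDiffOn
        ((contDiffOn_liouvilleForm hT hF.smoothFlow hθ' p).mono hsub) hz
    have h1 : HasFDerivWithinAt (fun y => liouvilleForm T F θ p y v)
        ((fderivWithin ℝ (liouvilleForm T F θ p) D z).flip v) D z := by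
      simpa using hd.clm_apply (hasFDerivWithinAt_const v z _)
    have h2 := ((JL n).hasFDerivAt.comp_hasFDerivWithinAt z
      ((hF.smoothFlow.hasFDerivWithinAt hz').mono hsub)).inner ℝ
      ((hF.smoothFlow.hasFDerivWithinAt_stDiff_apply hT hz' v).mono hsub)
    have h3 := (((hθ'.hasFDerivWithinAt hz').mono hsub).const_mul 2).mul_const v.1
    have h4 := (h2.sub h3).congr (fun y _ => liouvilleForm_apply T F θ p y v)
      (liouvilleForm_apply T F θ p z v)
    have h5 := congrArg (fun A : ℝ × E n →L[ℝ] ℝ => A u) ((hD z hz).eq h1 h4)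
    simp [fderivInnerCLM_apply] at h5
    rw [h5]; ring
  have hsplit : ∀ {W : Type} [NormedAddCommGroup W] [NormedSpace ℝ W] (A : ℝ × E n →L[ℝ] W)
      (u : ℝ × E n), A u = u.1 • A (1, 0) + A (0, u.2) := by
    intro W _ _ A u
    rw [← map_smul, ← map_add]; simp
  -- This is `F*ω = dθ ∧ dt`, where only the space part of `dθ` matters.
  have hω : ∀ u v, inner ℝ (J (stDiff T F p z u)) (stDiff T F p z v) =
      v.1 * stDiff T θ p z (0, u.2) - u.1 * stDiff T θ p z (0, v.2) := by
    intro u v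
    rw [hsplit (stDiff T F p z) u, hsplit (stDiff T F p z) v, ← JL_apply, map_add, map_smul]
    simp only [JL_apply, inner_add_left, inner_add_right, real_inner_smul_left,
      real_inner_smul_right, inner_J_self, hθ.inner_J_stDiff hn hT hF hz']
    have h0 : inner ℝ (J (stDiff T F p z (0, u.2))) (stDiff T F p z (0, v.2)) = 0 :=
      hF.inner_fderiv_eq_zero (t := z.1) (x := z.2) hz' _ _
    have h1 : inner ℝ (J (stDiff T F p z (1, 0))) (stDiff T F p z (0, v.2)) =
        - stDiff T θ p z (0, v.2) := by
      rw [inner_J_left, real_inner_comm, hθ.inner_J_stDiff hn hT hF hz']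
    rw [h0, h1]; ring
  rw [key, key, hω, hω, hF.smoothFlow.stDiff2_symm hT hz' u v, hsplit (stDiff T θ p z) u,
    hsplit (stDiff T θ p z) v]
  simp only [smul_eq_mul]
  ring

/-- Poincaré lemma on the convex product of a coordinate ball with the whole time interval, so that
no gluing in time is left to do. -/
lemma exists_liouville_primitive (hn : 0 < n) (hT : 0 < T) (hF : IsLagrangianMCF T F)
    {θ : ℝ → M → ℝ} (hθ : IsAngleFamily T F o θ) (p : M) :
    ∃ (r : ℝ) (b : ℝ × E n → ℝ), 0 < r ∧
      Metric.ball (coord p) r ⊆ (extChartAt 𝓘(ℝ, E n) p).target ∧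
      ContDiffOn ℝ ∞ b (timeInterval T ×ˢ Metric.ball (coord p) r) ∧
      ∀ z ∈ timeInterval T ×ˢ Metric.ball (coord p) r, HasFDerivWithinAt b
        (liouvilleForm T F θ p z) (timeInterval T ×ˢ Metric.ball (coord p) r) z := by
  obtain ⟨r, hr, hb⟩ := Metric.isOpen_iff.1 (isOpen_target p) (coord p : E n) (coord_mem p)
  have hsub : timeInterval T ×ˢ Metric.ball (coord p) r ⊆ dom n T p := prod_mono subset_rfl hb
  have hD : UniqueDiffOn ℝ (timeInterval T ×ˢ Metric.ball (coord p : E n) r) :=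
    uniqueDiffOn_timeInterval_prod hT Metric.isOpen_ball
  have hs := (contDiffOn_liouvilleForm hT hF.smoothFlow hθ.1 p).mono hsub
  obtain ⟨b, h⟩ := Convex.exists_forall_hasFDerivWithinAt_of_fderivWithin_symmetric
    ((convex_timeInterval T).prod (convex_ball (coord p : E n) r))
    (hs.differentiableOn (by simp))
    (fun z hz u _ v _ => liouvilleForm_closed hn hT hF hθ hD hsub hz u v)
  exact ⟨r, b, hr, hb, contDiffOn_infty_of_hasFDerivWithinAt hD h hs, h⟩

end Liouville

/-! ### Integration over chains and the initial multivalued primitive -/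

section Chains

variable {n : ℕ} {M : Type*} [TopologicalSpace M] [ChartedSpace (E n) M]

lemma boundary_add (c d : SmoothPath n M →₀ ℤ) : boundary (c + d) = boundary c + boundary d :=
  Finsupp.sum_add_index' (fun _ => zero_smul _ _) fun _ _ _ => add_smul _ _ _

lemma boundary_sub (c d : SmoothPath n M →₀ ℤ) : boundary (c - d) = boundary c - boundary d :=
  Finsupp.sum_sub_index fun _ _ _ => sub_smul _ _ _

lemma liouvilleIntegral_add (F : M → V n) (c d : SmoothPath n M →₀ ℤ) :
    liouvilleIntegral F (c + d) = liouvilleIntegral F c + liouvilleIntegral F d :=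
  Finsupp.sum_add_index' (fun _ => by simp) fun _ _ _ => by push_cast; ring

lemma liouvilleIntegral_sub (F : M → V n) (c d : SmoothPath n M →₀ ℤ) :
    liouvilleIntegral F (c - d) = liouvilleIntegral F c - liouvilleIntegral F d :=
  Finsupp.sum_sub_index fun _ _ _ => by push_cast; ring

lemma boundary_single (σ : SmoothPath n M) :
    boundary (Finsupp.single σ 1) = Finsupp.single (σ.1 1) 1 - Finsupp.single (σ.1 0) 1 := by
  rw [boundary, Finsupp.sum_single_index (by simp), one_smul]

lemma liouvilleIntegral_single (F : M → V n) (σ : SmoothPath n M) :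
    liouvilleIntegral F (Finsupp.single σ 1) =
      ∫ s in (0 : ℝ)..1, liouville (F (σ.1 s)) (deriv (F ∘ σ.1) s) := by
  rw [liouvilleIntegral, Finsupp.sum_single_index (by simp), Int.cast_one, one_mul]

/-- The chain `c` goes from `p` to `q`. -/
def ChainFromTo (c : SmoothPath n M →₀ ℤ) (p q : M) : Prop :=
  boundary c = Finsupp.single q 1 - Finsupp.single p 1

/-- Being joined by a chain. -/
def chainSetoid (n : ℕ) (M : Type*) [TopologicalSpace M] [ChartedSpace (E n) M] : Setoid M where
  r p q := ∃ c : SmoothPath n M →₀ ℤ, ChainFromTo c p q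
  iseqv :=
    { refl := fun p => ⟨0, by simp [ChainFromTo, boundary]⟩
      symm := by
        rintro p q ⟨c, hc⟩
        refine ⟨0 - c, ?_⟩
        have h0 : boundary (0 : SmoothPath n M →₀ ℤ) = 0 := by simp [boundary]
        rw [ChainFromTo] at *
        rw [boundary_sub, hc, h0]
        abel
      trans := by
        rintro p q r ⟨c, hc⟩ ⟨d, hd⟩
        refine ⟨c + d, ?_⟩
        rw [ChainFromTo] at *
        rw [boundary_add, hc, hd]
        abel }

/-- For a rational Lagrangian, the Liouville form has a primitive with values in `ℝ / 2πaℤ`. -/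
lemma IsRational.exists_primitive {F : M → V n} {a : ℝ} (h : IsRational F a) :
    ∃ β : M → AddCircle (2 * Real.pi * a), ∀ (c : SmoothPath n M →₀ ℤ) (p q : M),
      ChainFromTo c p q → β q = β p + (liouvilleIntegral F c : AddCircle (2 * Real.pi * a)) := by
  let S := chainSetoid n M
  -- One base point for each class of points joined by chains, so `M` need not be connected. Two
  -- chains from the base point to the same point differ by a cycle, whose integral lies in `2πaℤ`.
  let base : M → M := fun p => Quotient.out (Quotient.mk S p)
  have hbase : ∀ p, ∃ c : SmoothPath n M →₀ ℤ, ChainFromTo c (base p) p :=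
    fun p => Quotient.exact (Quotient.out_eq (Quotient.mk S p))
  choose C hC using hbase
  refine ⟨fun p => (liouvilleIntegral F (C p) : AddCircle (2 * Real.pi * a)), fun c p q hc => ?_⟩
  have hpq : base p = base q :=
    congrArg Quotient.out (Quotient.sound (s := S) (show ∃ c, _ from ⟨c, hc⟩))
  have h0 : boundary (C q - (C p + c)) = 0 := by
    have h1 := hC p
    have h2 := hC q
    rw [ChainFromTo] at *
    rw [boundary_sub, boundary_add, h1, h2, hc, hpq]
    abel
  have h1 : liouvilleIntegral F (C q - (C p + c)) ∈ liouvillePeriods F := ⟨_, h0, rfl⟩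
  rw [h] at h1
  obtain ⟨k, hk⟩ := h1
  rw [liouvilleIntegral_sub, liouvilleIntegral_add] at hk
  rw [← AddCircle.coe_add, ← sub_eq_zero, ← AddCircle.coe_sub, AddCircle.coe_eq_zero_iff]
  exact ⟨k, by rw [hk, zsmul_eq_mul]; ring⟩

end Chains

/-! ### Gluing local primitives to a multivalued function -/

section Gluing

variable {n : ℕ} {M : Type*} [TopologicalSpace M] [ChartedSpace (E n) M] {T : EReal}
  {F : ℝ → M → V n}

/-- `b` is, in the chart around `p`, a branch of `β` over `[0, T) × B` which is a primitive of the
form `⟨J F, dF⟩ - 2 θ dt`. -/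
structure IsLocalPrimitive (T : EReal) (F : ℝ → M → V n) (θ : ℝ → M → ℝ) {a : ℝ}
    (β : ℝ → M → AddCircle (2 * Real.pi * a)) (p : M) (r : ℝ) (b : ℝ × E n → ℝ) : Prop where
  pos : 0 < r
  subset : Metric.ball (coord p) r ⊆ (extChartAt 𝓘(ℝ, E n) p).target
  smooth : ContDiffOn ℝ ∞ b (timeInterval T ×ˢ Metric.ball (coord p) r)
  hasFDerivWithinAt : ∀ z ∈ timeInterval T ×ˢ Metric.ball (coord p) r, HasFDerivWithinAt b
        (liouvilleForm T F θ p z) (timeInterval T ×ˢ Metric.ball (coord p) r) z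
  lift : ∀ t ∈ timeInterval T, ∀ x ∈ Metric.ball (coord p : E n) r,
    (b (t, x) : AddCircle (2 * Real.pi * a)) = β t ((extChartAt 𝓘(ℝ, E n) p).symm x)

/-- Near a point, every branch differs from the local primitive by a constant. -/
lemma IsLocalPrimitive.branch_eq {θ : ℝ → M → ℝ} {a : ℝ}
    {β : ℝ → M → AddCircle (2 * Real.pi * a)} {p : M} {r : ℝ} {b : ℝ × E n → ℝ}
    (h : IsLocalPrimitive T F θ β p r b) {U : Set (ℝ × M)} {b' : ℝ → M → ℝ}
    (hb' : IsBranch (n := n) T β U b') {t : ℝ} (ht : (t, p) ∈ U ∩ spacetime M T) :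
    ∃ δ > 0, ∃ c : ℝ, δ ≤ r ∧ ∀ s ∈ timeInterval T ∩ Metric.ball t δ,
      ∀ y ∈ Metric.ball (coord p : E n) δ, localRep (b' s) p y = b (s, y) + c := by
  have hcont : ContinuousAt (fun z : ℝ × E n => (z.1, (extChartAt 𝓘(ℝ, E n) p).symm z.2))
      (t, coord p) :=
    continuousAt_fst.prodMk (ContinuousAt.comp (f := Prod.snd) (x := (t, (coord p : E n)))
      (continuousAt_extChartAt_symm p) continuousAt_snd)
  have hU : (fun z : ℝ × E n => (z.1, (extChartAt 𝓘(ℝ, E n) p).symm z.2)) ⁻¹' U ∈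
      𝓝 (t, (coord p : E n)) := by
    refine hcont.preimage_mem_nhds (hb'.isOpen.mem_nhds ?_)
    simp only [symm_coord]
    exact ht.1
  obtain ⟨ε, hε, hεU⟩ := Metric.mem_nhds_iff.1 hU
  rw [← ball_prod_same] at hεU
  set δ := min ε r with hδ
  have hδ0 : 0 < δ := lt_min hε h.pos
  -- `N` is convex, hence connected, and on it two branches differ by a continuous function with
  -- values in the discrete group `2πaℤ`.
  set N : Set (ℝ × E n) := (timeInterval T ∩ Metric.ball t δ) ×ˢ Metric.ball (coord p) δ with hN
  have hNr : N ⊆ timeInterval T ×ˢ Metric.ball (coord p) r :=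
    prod_mono inter_subset_left (Metric.ball_subset_ball (min_le_right _ _))
  have hNU : ∀ z ∈ N, (z.1, (extChartAt 𝓘(ℝ, E n) p).symm z.2) ∈ U ∩ spacetime M T := fun z hz =>
    ⟨hεU ⟨Metric.ball_subset_ball (min_le_left _ _) hz.1.2,
      Metric.ball_subset_ball (min_le_left _ _) hz.2⟩, hz.1.1, mem_univ _⟩
  have hpre : IsPreconnected N :=
    (((convex_timeInterval T).inter (convex_ball _ _)).prod (convex_ball _ _)).isPreconnected
  have hg : ContinuousOn (fun z => chartRep b' p z - b z) N := by
    refine ContinuousOn.sub ?_ (h.smooth.continuousOn.mono hNr)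
    have h1 : ContinuousOn (fun z : ℝ × E n => (z.1, (extChartAt 𝓘(ℝ, E n) p).symm z.2)) N :=
      continuousOn_fst.prodMk ((continuousOn_extChartAt_symm p).comp continuousOn_snd
        fun z hz => h.subset (hNr hz).2)
    exact hb'.smooth.continuousOn.comp h1 hNU
  have hz : ∀ z ∈ N, chartRep b' p z - b z ∈ AddSubgroup.zmultiples (2 * Real.pi * a) := by
    intro z hz
    have h1 := hb'.lift _ _ (hNU z hz)
    have h2 := h.lift z.1 (hNr hz).1 z.2 (hNr hz).2
    rw [← h2] at h1
    have h3 := QuotientAddGroup.eq.1 h1.symm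
    have : chartRep b' p z - b z = -b (z.1, z.2) + b' z.1 ((extChartAt 𝓘(ℝ, E n) p).symm z.2) := by
      rw [chartRep]; ring
    rw [this]
    exact h3
  have hc : (t, (coord p : E n)) ∈ N :=
    ⟨⟨ht.2.1, Metric.mem_ball_self hδ0⟩, Metric.mem_ball_self hδ0⟩
  refine ⟨δ, hδ0, chartRep b' p (t, (coord p : E n)) - b (t, coord p), min_le_right _ _,
    fun s hs y hy => ?_⟩
  rw [← eq_of_mem_zmultiples hpre hg hz (show (s, y) ∈ N from ⟨hs, hy⟩) hc, chartRep_mk]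
  ring

variable [IsManifold 𝓘(ℝ, E n) ∞ M]
  {o : ∀ p : M, Orientation ℝ (TangentSpace 𝓘(ℝ, E n) p) (Fin n)}

/-- A smooth parametrization of the segment from `x` to `y`, constant near its ends. -/
def segPath (x y : E n) (s : ℝ) : E n := x + Real.smoothTransition s • (y - x)

lemma contDiff_segPath (x y : E n) : ContDiff ℝ ∞ (segPath x y) :=
  contDiff_const.add (Real.smoothTransition.contDiff.smul contDiff_const)

/-- Smooth paths are given on all of `ℝ`, so the path must stay in the ball for every real `s`; this
is why a cutoff with values in `[0, 1]` is used. -/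
lemma segPath_mem {B : Set (E n)} (hB : Convex ℝ B) {x y : E n} (hx : x ∈ B) (hy : y ∈ B)
    (s : ℝ) : segPath x y s ∈ B :=
  hB.add_smul_sub_mem hx hy ⟨Real.smoothTransition.nonneg s, Real.smoothTransition.le_one s⟩

/-- A smooth path in a coordinate ball. -/
def chartPath (p : M) {B : Set (E n)} (hB : Convex ℝ B)
    (hsub : B ⊆ (extChartAt 𝓘(ℝ, E n) p).target) {x y : E n} (hx : x ∈ B) (hy : y ∈ B) :
    SmoothPath n M :=
  ⟨fun s => (extChartAt 𝓘(ℝ, E n) p).symm (segPath x y s), by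
    rw [← contMDiffOn_univ]
    exact (contMDiffOn_extChartAt_symm p).comp (contDiff_segPath x y).contMDiff.contMDiffOn
      fun s _ => hsub (segPath_mem hB hx hy s)⟩

lemma chainFromTo_chartPath (p : M) {B : Set (E n)} (hB : Convex ℝ B)
    (hsub : B ⊆ (extChartAt 𝓘(ℝ, E n) p).target) {x y : E n} (hx : x ∈ B) (hy : y ∈ B) :
    ChainFromTo (Finsupp.single (chartPath p hB hsub hx hy) 1)
      ((extChartAt 𝓘(ℝ, E n) p).symm x) ((extChartAt 𝓘(ℝ, E n) p).symm y) := by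
  rw [ChainFromTo, boundary_single]
  simp [chartPath, segPath]

/-- Fundamental theorem of calculus: on the slice `t = 0` the form `⟨JF, dF⟩ - 2θ dt` restricts to
the Liouville form. -/
lemma liouvilleIntegral_chartPath (hT : 0 < T) (hF : SmoothFlow n T F) {θ : ℝ → M → ℝ} (p : M)
    {B : Set (E n)} (hB : Convex ℝ B) (hBo : IsOpen B)
    (hsub : B ⊆ (extChartAt 𝓘(ℝ, E n) p).target) {x y : E n} (hx : x ∈ B) (hy : y ∈ B)
    {b : ℝ × E n → ℝ} (hbs : ContDiffOn ℝ ∞ b (timeInterval T ×ˢ B))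
    (hb : ∀ z ∈ timeInterval T ×ˢ B,
      HasFDerivWithinAt b (liouvilleForm T F θ p z) (timeInterval T ×ˢ B) z) :
    liouvilleIntegral (F 0) (Finsupp.single (chartPath p hB hsub hx hy) 1) =
      b (0, y) - b (0, x) := by
  have h0 := zero_mem_timeInterval hT
  have hmem : ∀ s, (0, segPath x y s) ∈ timeInterval T ×ˢ B :=
    fun s => ⟨h0, segPath_mem hB hx hy s⟩
  have hγ : ∀ s, HasDerivAt (segPath x y) (deriv (segPath x y) s) s := fun s =>
    ((contDiff_segPath x y).differentiable (by simp) s).hasDerivAt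
  have hd : ∀ s, HasDerivAt (fun s => b (0, segPath x y s))
      (liouvilleForm T F θ p (0, segPath x y s) (0, deriv (segPath x y) s)) s := by
    intro s
    have h1 := hasFDerivAt_slice hBo (hb _ (hmem s)) h0 (hmem s).2
    have h2 := h1.comp_hasDerivAt s (hγ s)
    rw [ContinuousLinearMap.comp_apply, ContinuousLinearMap.inr_apply] at h2
    exact h2
  have hF' : ∀ s, deriv (F 0 ∘ (chartPath p hB hsub hx hy).1) s =
      stDiff T F p (0, segPath x y s) (0, deriv (segPath x y) s) := by
    intro s
    have h1 := hF.hasFDerivAt_localRep (show (0, segPath x y s) ∈ dom n T p from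
      ⟨h0, hsub (hmem s).2⟩)
    have h2 := (h1.comp_hasDerivAt s (hγ s)).deriv
    rw [ContinuousLinearMap.comp_apply, ContinuousLinearMap.inr_apply] at h2
    exact h2
  have hsm : ContDiff ℝ ∞ (fun s => b (0, segPath x y s)) := by
    rw [← contDiffOn_univ]
    exact hbs.comp (contDiff_const.prodMk (contDiff_segPath x y)).contDiffOn fun s _ => hmem s
  have hcont : Continuous (deriv fun s => b (0, segPath x y s)) := hsm.continuous_deriv (by simp)
  have h1 : ∀ s, liouville (F 0 ((chartPath p hB hsub hx hy).1 s))
      (deriv (F 0 ∘ (chartPath p hB hsub hx hy).1) s) =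
      deriv (fun s => b (0, segPath x y s)) s := by
    intro s
    rw [hF', (hd s).deriv, liouvilleForm_apply, liouville_eq_inner]
    simp [chartRep, chartPath]
  rw [liouvilleIntegral_single]
  simp only [h1]
  rw [intervalIntegral.integral_deriv_eq_sub (fun s _ => (hd s).differentiableAt)
    (hcont.intervalIntegrable _ _)]
  simp [segPath]

/-- The right side does not involve the chart, so primitives in different charts have the same time
derivative at a point of `M`. -/
lemma liouvilleForm_time (hT : 0 < T) (hF : IsLagrangianMCF T F) (θ : ℝ → M → ℝ) {p q : M} {t : ℝ}
    {x : E n} (hz : (t, x) ∈ dom n T p) (hq : (extChartAt 𝓘(ℝ, E n) p).symm x = q) :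
    liouvilleForm T F θ p (t, x) (1, 0) =
      inner ℝ (J (F t q)) (meanCurvature (F t) q) - 2 * θ t q := by
  rw [liouvilleForm_apply, hF.stDiff_time hT hz, hq, chartRep, chartRep, hq, mul_one]

/-- The initial primitive `β₀` rests on arbitrary choices of chains. Its regularity comes from paths
inside a chart, along which it changes by the smooth local primitive modulo `2πa`. -/
lemma exists_isLocalPrimitive (hn : 0 < n) (hT : 0 < T) (hF : IsLagrangianMCF T F)
    {a : ℝ} (hr : IsRational (F 0) a) {θ : ℝ → M → ℝ} (hθ : IsAngleFamily T F o θ) :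
    ∃ β : ℝ → M → AddCircle (2 * Real.pi * a),
      ∀ p, ∃ r b, IsLocalPrimitive T F θ β p r b := by
  obtain ⟨β₀, hβ₀⟩ := hr.exists_primitive
  choose r b hr hsub hbs hb using fun p => exists_liouville_primitive hn hT hF hθ p
  have h0 := zero_mem_timeInterval hT
  refine ⟨fun t q => β₀ q + (b q (t, coord q) - b q (0, coord q) : ℝ), fun p => ?_⟩
  obtain ⟨B, hB⟩ := QuotientAddGroup.mk_surjective (β₀ p)
  have hc : coord p ∈ Metric.ball (coord p : E n) (r p) := Metric.mem_ball_self (hr p)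
  refine ⟨r p, fun z => b p z + (B - b p (0, coord p)), hr p, hsub p,
    (hbs p).add contDiffOn_const, fun z hz => (hb p z hz).add_const _, fun t ht x hx => ?_⟩
  set q := (extChartAt 𝓘(ℝ, E n) p).symm x with hq
  have h1 := hβ₀ _ _ _ (chainFromTo_chartPath p (convex_ball _ _) (hsub p) hc hx)
  rw [liouvilleIntegral_chartPath hT hF.smoothFlow p (convex_ball _ _) Metric.isOpen_ball (hsub p)
    hc hx (hbs p) (hb p), symm_coord, ← hq] at h1
  -- The change in time was read in the chart around `q`; here it is transferred to the chart around
  -- `p`.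
  have h2 : b q (t, coord q) - b p (t, x) = b q (0, coord q) - b p (0, x) := by
    have hd : ∀ s ∈ timeInterval T,
        HasDerivWithinAt (fun s => b q (s, coord q) - b p (s, x)) 0 (timeInterval T) s := by
      intro s hs
      have hq' : coord q ∈ Metric.ball (coord q : E n) (r q) := Metric.mem_ball_self (hr q)
      have e1 := hasDerivWithinAt_slice (hb q (s, coord q) ⟨hs, hq'⟩) hq'
      have e2 := hasDerivWithinAt_slice (hb p (s, x) ⟨hs, hx⟩) hx
      have e3 := e1.sub e2
      rw [liouvilleForm_time hT hF θ (coord_mem_dom hs q) (symm_coord q),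
        liouvilleForm_time hT hF θ ⟨hs, hsub p hx⟩ hq.symm, sub_self] at e3
      exact e3
    refine (convex_timeInterval T).is_const_of_fderivWithin_eq_zero (𝕜 := ℝ)
      (f := fun s => b q (s, coord q) - b p (s, x))
      (fun s hs => (hd s hs).differentiableWithinAt) (fun s hs => ?_) ht h0
    have := (hd s hs).hasFDerivWithinAt.fderivWithin (uniqueDiffOn_timeInterval hT s hs)
    rw [this]
    ext
    simp
  change ((b p (t, x) + (B - b p (0, coord p)) : ℝ) : AddCircle (2 * Real.pi * a)) =
    β₀ q + ((b q (t, coord q) - b q (0, coord q) : ℝ) : AddCircle (2 * Real.pi * a))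
  rw [h1, ← hB]
  have h3 : b p (t, x) + (B - b p (0, coord p)) =
      B + (b p (0, x) - b p (0, coord p)) + (b q (t, coord q) - b q (0, coord q)) := by
    linarith
  rw [h3, AddCircle.coe_add, AddCircle.coe_add]

lemma IsLocalPrimitive.isBranch {θ : ℝ → M → ℝ} {a : ℝ}
    {β : ℝ → M → AddCircle (2 * Real.pi * a)} {p : M} {r : ℝ} {b : ℝ × E n → ℝ}
    (h : IsLocalPrimitive T F θ β p r b) :
    IsBranch (n := n) T β (chartNhd p (Metric.ball (coord p : E n) r))
      (fun t q => b (t, extChartAt 𝓘(ℝ, E n) p q)) where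
  isOpen := isOpen_chartNhd p Metric.isOpen_ball
  smooth := contMDiffOn_of_chart h.smooth fun _ _ _ _ _ => rfl
  lift t q hq := by
    have h1 := h.lift t hq.2.1 _ hq.1.2.2
    rwa [(extChartAt 𝓘(ℝ, E n) p).left_inv hq.1.2.1] at h1

/-- Stated on a neighbourhood because the Laplacian differentiates this identity once more. -/
lemma IsLocalPrimitive.pderiv_branch (hF : IsLagrangianMCF T F) {θ : ℝ → M → ℝ} {a : ℝ}
    {β : ℝ → M → AddCircle (2 * Real.pi * a)} {p : M} {r : ℝ} {b : ℝ × E n → ℝ}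
    (h : IsLocalPrimitive T F θ β p r b) {U : Set (ℝ × M)} {b' : ℝ → M → ℝ}
    (hb' : IsBranch (n := n) T β U b') {t : ℝ} (ht : (t, p) ∈ U ∩ spacetime M T) (j : Fin n) :
    ∀ᶠ y in 𝓝 (coord p : E n), pderiv j (localRep (b' t) p) y =
      inner ℝ (J (localRep (F t) p y)) (pderiv j (localRep (F t) p) y) := by
  obtain ⟨δ, hδ, c, hδr, hc⟩ := h.branch_eq hb' ht
  filter_upwards [Metric.ball_mem_nhds (coord p : E n) hδ] with y hy
  have hyr : y ∈ Metric.ball (coord p : E n) r := Metric.ball_subset_ball hδr hy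
  have hy' : (t, y) ∈ dom n T p := ⟨ht.2.1, h.subset hyr⟩
  have h1 := (hasFDerivAt_slice Metric.isOpen_ball (h.hasFDerivWithinAt (t, y) ⟨ht.2.1, hyr⟩)
    ht.2.1 hyr).add_const c
  have h2 : HasFDerivAt (localRep (b' t) p)
      ((liouvilleForm T F θ p (t, y)).comp (ContinuousLinearMap.inr ℝ ℝ (E n))) y := by
    refine h1.congr_of_eventuallyEq ?_
    filter_upwards [Metric.isOpen_ball.mem_nhds hy] with w hw
    exact hc t ⟨ht.2.1, Metric.mem_ball_self hδ⟩ w hw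
  rw [pderiv, h2.fderiv, hF.smoothFlow.pderiv_localRep hy']
  simp [liouvilleForm_apply, chartRep_mk]

lemma IsLocalPrimitive.hasDerivWithinAt_branch (hT : 0 < T) (hF : IsLagrangianMCF T F)
    {θ : ℝ → M → ℝ} {a : ℝ}
    {β : ℝ → M → AddCircle (2 * Real.pi * a)} {p : M} {r : ℝ} {b : ℝ × E n → ℝ}
    (h : IsLocalPrimitive T F θ β p r b) {U : Set (ℝ × M)} {b' : ℝ → M → ℝ}
    (hb' : IsBranch (n := n) T β U b') {t : ℝ} (ht : (t, p) ∈ U ∩ spacetime M T) :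
    HasDerivWithinAt (fun s => b' s p)
      (inner ℝ (J (F t p)) (meanCurvature (F t) p) - 2 * θ t p) (timeInterval T) t := by
  obtain ⟨δ, hδ, c, hδr, hc⟩ := h.branch_eq hb' ht
  have hp : coord p ∈ Metric.ball (coord p : E n) r := Metric.mem_ball_self h.pos
  have h1 := (hasDerivWithinAt_slice (h.hasFDerivWithinAt (t, coord p) ⟨ht.2.1, hp⟩) hp).add_const c
  rw [liouvilleForm_time hT hF θ (coord_mem_dom ht.2.1 p) (symm_coord p)] at h1
  have h2 : ∀ s ∈ timeInterval T ∩ Metric.ball t δ, b' s p = b (s, coord p) + c := by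
    intro s hs
    rw [← hc s hs _ (Metric.mem_ball_self hδ), localRep_coord]
  refine h1.congr_of_eventuallyEq ?_ (h2 t ⟨ht.2.1, Metric.mem_ball_self hδ⟩)
  filter_upwards [self_mem_nhdsWithin, mem_nhdsWithin_of_mem_nhds (Metric.ball_mem_nhds t hδ)]
    with s hs hs'
  exact h2 s ⟨hs, hs'⟩

/-- The multivalued primitives of the Liouville form, with their evolution equation. -/
lemma exists_liouvillePrimitive (hn : 0 < n) (hT : 0 < T) (hF : IsLagrangianMCF T F)
    {a : ℝ} (hr : IsRational (F 0) a) {θ : ℝ → M → ℝ} (hθ : IsAngleFamily T F o θ) :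
    ∃ β : ℝ → M → AddCircle (2 * Real.pi * a),
      IsLiouvillePrimitive T F β ∧ LiouvilleEvolution T F θ β := by
  obtain ⟨β, hβ⟩ := exists_isLocalPrimitive hn hT hF hr hθ
  refine ⟨β, ⟨?_, ?_⟩, ?_⟩
  · rintro ⟨t, p⟩ hz
    obtain ⟨r, b, h⟩ := hβ p
    refine ⟨_, _, ?_, h.isBranch⟩
    exact ⟨mem_univ _, mem_extChartAt_source p, Metric.mem_ball_self h.pos⟩
  · intro U b' hb' t p ht
    obtain ⟨r, b, h⟩ := hβ p
    rw [hF.tangentialPart_eq ht.2.1]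
    refine gradient_eq_of_pderiv_eq fun j => ?_
    rw [(h.pderiv_branch hF hb' ht j).self_of_nhds, localRep_coord]
    rfl
  · intro U b' hb' t p ht
    obtain ⟨r, b, h⟩ := hβ p
    rw [hF.laplacian_primitive hT ht.2.1 (h.pderiv_branch hF hb' ht)]
    exact h.hasDerivWithinAt_branch hT hF hb' ht

end Gluing

/-! ### Chain rules for the Laplacian -/

section Cosine

variable {n : ℕ} {M : Type*} [TopologicalSpace M] [ChartedSpace (E n) M]

lemma laplacian_congr {F : M → V n} {f g : M → ℝ} {p : M}
    (h : localRep f p =ᶠ[𝓝 (coord p : E n)] localRep g p) :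
    laplacian F f p = laplacian F g p := by
  have h1 : ∀ j, pderiv j (localRep f p) =ᶠ[𝓝 (coord p : E n)] pderiv j (localRep g p) := fun j =>
    h.fderiv.mono fun y hy => by rw [pderiv, pderiv, hy]
  have h2 : ∀ i j, pderiv i (pderiv j (localRep f p)) (coord p) =
      pderiv i (pderiv j (localRep g p)) (coord p) := fun i j => by
    rw [pderiv, (h1 j).fderiv_eq]; rfl
  simp only [laplacian, h2, (h1 _).self_of_nhds]

lemma differentiableAt_pderiv_of_contDiffAt {W : Type*} [NormedAddCommGroup W] [NormedSpace ℝ W]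
    {f : E n → W} {x : E n} (hf : ContDiffAt ℝ ∞ f x) (j : Fin n) :
    DifferentiableAt ℝ (pderiv j f) x := by
  have h1 : ContDiffAt ℝ ∞ (fderiv ℝ f) x := hf.fderiv_right (by simp)
  exact (h1.differentiableAt (by simp)).clm_apply (differentiableAt_const _)

lemma eventually_differentiableAt {W : Type*} [NormedAddCommGroup W] [NormedSpace ℝ W]
    {f : E n → W} {x : E n} (hf : ContDiffAt ℝ ∞ f x) : ∀ᶠ y in 𝓝 x, DifferentiableAt ℝ f y := by
  have h1 : ContDiffAt ℝ 1 f x := hf.of_le (by simp)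
  exact (h1.eventually (by simp)).mono fun y hy => hy.differentiableAt (by simp)

lemma pderiv_add_const_mul {f g : E n → ℝ} {x : E n} (hf : DifferentiableAt ℝ f x)
    (hg : DifferentiableAt ℝ g x) (c : ℝ) (j : Fin n) :
    pderiv j (fun y => f y + c * g y) x = pderiv j f x + c * pderiv j g x := by
  have h := hf.hasFDerivAt.add (hg.hasFDerivAt.const_mul c)
  have h' : HasFDerivAt (fun y => f y + c * g y) _ x := h
  rw [pderiv, h'.fderiv]
  simp [pderiv]

lemma laplacian_add_const_mul {F : M → V n} {f g : M → ℝ} {p : M}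
    (hf : ContDiffAt ℝ ∞ (localRep f p) (coord p : E n))
    (hg : ContDiffAt ℝ ∞ (localRep g p) (coord p : E n)) (c : ℝ) :
    laplacian F (fun q => f q + c * g q) p = laplacian F f p + c * laplacian F g p := by
  have h1 : ∀ j, pderiv j (localRep (fun q => f q + c * g q) p) =ᶠ[𝓝 (coord p : E n)]
      fun y => pderiv j (localRep f p) y + c * pderiv j (localRep g p) y := by
    intro j
    filter_upwards [eventually_differentiableAt hf,
      eventually_differentiableAt hg] with y hfy hgy
    exact pderiv_add_const_mul hfy hgy c j
  have h2 : ∀ i j, pderiv i (pderiv j (localRep (fun q => f q + c * g q) p)) (coord p : E n) =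
      pderiv i (pderiv j (localRep f p)) (coord p) +
        c * pderiv i (pderiv j (localRep g p)) (coord p) := by
    intro i j
    rw [pderiv, (h1 j).fderiv_eq]
    exact pderiv_add_const_mul (differentiableAt_pderiv_of_contDiffAt hf j)
      (differentiableAt_pderiv_of_contDiffAt hg j) c i
  simp only [laplacian, h2, (h1 _).self_of_nhds, Finset.mul_sum, ← Finset.sum_add_distrib]
  refine Finset.sum_congr rfl fun i _ => Finset.sum_congr rfl fun j _ => ?_
  simp only [mul_add, Finset.sum_add_distrib, mul_left_comm _ c, ← Finset.mul_sum]
  ring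

lemma pderiv_cos {w : E n → ℝ} {x : E n} (hw : DifferentiableAt ℝ w x) (κ : ℝ) (j : Fin n) :
    pderiv j (fun y => Real.cos (κ * w y)) x = -(κ * Real.sin (κ * w x)) * pderiv j w x := by
  have h := (hw.hasFDerivAt.const_mul κ).cos
  rw [pderiv, h.fderiv]
  simp [pderiv]; ring

lemma pderiv_sin_mul {w v : E n → ℝ} {x : E n} (hw : DifferentiableAt ℝ w x)
    (hv : DifferentiableAt ℝ v x) (κ : ℝ) (i : Fin n) :
    pderiv i (fun y => -(κ * Real.sin (κ * w y)) * v y) x =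
      -(κ * Real.sin (κ * w x)) * pderiv i v x -
        κ ^ 2 * Real.cos (κ * w x) * (pderiv i w x * v x) := by
  have h := (((hw.hasFDerivAt.const_mul κ).sin.const_mul κ).neg).mul hv.hasFDerivAt
  have h' : HasFDerivAt (fun y => -(κ * Real.sin (κ * w y)) * v y) _ x := h
  rw [pderiv, h'.fderiv]
  simp [pderiv]; ring

/-- The chain rule for the Laplacian of `cos (κ w)`. -/
lemma laplacian_cos {F : M → V n} {w : M → ℝ} {p : M}
    (hw : ContDiffAt ℝ ∞ (localRep w p) (coord p : E n)) (κ : ℝ) :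
    laplacian F (fun q => Real.cos (κ * w q)) p =
      -(κ * Real.sin (κ * w p)) * laplacian F w p - κ ^ 2 * Real.cos (κ * w p) *
        ∑ i, ∑ j, (gramMat (frameAt F p (coord p)))⁻¹ i j *
          (pderiv i (localRep w p) (coord p) * pderiv j (localRep w p) (coord p)) := by
  have h1 : ∀ j, pderiv j (localRep (fun q => Real.cos (κ * w q)) p) =ᶠ[𝓝 (coord p : E n)]
      fun y => -(κ * Real.sin (κ * localRep w p y)) * pderiv j (localRep w p) y := by
    intro j
    filter_upwards [eventually_differentiableAt hw] with y hy
    exact pderiv_cos hy κ j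
  have h2 : ∀ i j, pderiv i (pderiv j (localRep (fun q => Real.cos (κ * w q)) p)) (coord p : E n) =
      -(κ * Real.sin (κ * w p)) * pderiv i (pderiv j (localRep w p)) (coord p) -
        κ ^ 2 * Real.cos (κ * w p) *
          (pderiv i (localRep w p) (coord p) * pderiv j (localRep w p) (coord p)) := by
    intro i j
    rw [pderiv, (h1 j).fderiv_eq]
    have := pderiv_sin_mul (hw.differentiableAt (by simp))
      (differentiableAt_pderiv_of_contDiffAt hw j) κ i
    rw [localRep_coord] at this
    exact this
  simp only [laplacian, h2, (h1 _).self_of_nhds, localRep_coord, Finset.mul_sum,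
    ← Finset.sum_sub_distrib]
  refine Finset.sum_congr rfl fun i _ => Finset.sum_congr rfl fun j _ => ?_
  rw [← metric_eq_gramMat]
  simp only [mul_left_comm _ (-(κ * Real.sin (κ * w p))), ← Finset.mul_sum]
  ring

end Cosine

/-! ### Evolution of the cosine -/

section Evolution

variable {n : ℕ} {M : Type*} [TopologicalSpace M] [ChartedSpace (E n) M] {T : EReal}
  {F : ℝ → M → V n} [IsManifold 𝓘(ℝ, E n) ∞ M]
  {o : ∀ p : M, Orientation ℝ (TangentSpace 𝓘(ℝ, E n) p) (Fin n)}

/-- The value of `cos (k (b + s) / d)` does not depend on the branch `b`. -/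
lemma cos_eq_of_coe_eq {a : ℝ} {b b' : ℝ}
    (h : (b : AddCircle (2 * Real.pi * a)) = b') (k : ℤ) (s : ℝ) :
    Real.cos (k * (b + s) / divisor a) = Real.cos (k * (b' + s) / divisor a) := by
  have h1 : ((b - b' : ℝ) : AddCircle (2 * Real.pi * a)) = 0 := by
    rw [AddCircle.coe_sub, h, sub_self]
  obtain ⟨m, hm⟩ := (AddCircle.coe_eq_zero_iff _).1 h1
  rw [zsmul_eq_mul] at hm
  by_cases ha : a = 0
  -- In the exact case the period is `0`, so the two branches have equal values.
  · rw [ha, mul_zero, mul_zero] at hm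
    rw [sub_eq_zero.1 hm.symm]
  · have hd : divisor a = a := if_neg ha
    have h2 : k * (b + s) / divisor a = k * (b' + s) / divisor a +
        ((k * m : ℤ) : ℝ) * (2 * Real.pi) := by
      rw [hd]
      field_simp
      push_cast
      linear_combination (-(k : ℝ)) * hm
    rw [h2, Real.cos_add_int_mul_two_pi]

lemma IsBranch.contDiffAt_localRep {a : ℝ} {β : ℝ → M → AddCircle (2 * Real.pi * a)}
    {U : Set (ℝ × M)} {b : ℝ → M → ℝ} (hb : IsBranch (n := n) T β U b) {t : ℝ} {p : M}
    (ht : (t, p) ∈ U ∩ spacetime M T) : ContDiffAt ℝ ∞ (localRep (b t) p) (coord p : E n) := by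
  have h1 : ContMDiffAt 𝓘(ℝ, E n) (𝓘(ℝ, ℝ).prod 𝓘(ℝ, E n)) ∞
      (fun y : E n => (t, (extChartAt 𝓘(ℝ, E n) p).symm y)) (coord p) :=
    contMDiffAt_const.prodMk ((contMDiffOn_extChartAt_symm p).contMDiffAt
      ((isOpen_target p).mem_nhds (coord_mem p)))
  have h2 : (fun y : E n => (t, (extChartAt 𝓘(ℝ, E n) p).symm y)) ⁻¹' (U ∩ spacetime M T) ∈
      𝓝 (coord p : E n) := by
    have h3 := h1.continuousAt.preimage_mem_nhds (hb.isOpen.mem_nhds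
      (by rw [symm_coord]; exact ht.1))
    filter_upwards [h3] with y hy
    exact ⟨hy, ht.2.1, mem_univ _⟩
  rw [← contMDiffAt_iff_contDiffAt]
  have h4 := hb.smooth (t, (extChartAt 𝓘(ℝ, E n) p).symm (coord p))
    (by rw [symm_coord]; exact ht)
  have h5 := ContMDiffWithinAt.comp (coord p) h4 (h1.contMDiffWithinAt (s := _)) (mapsTo_preimage _ _)
  exact h5.contMDiffAt h2

lemma SmoothFlow.contDiffAt_localRep {W : Type*} [NormedAddCommGroup W] [NormedSpace ℝ W]
    {f : ℝ → M → W} (hf : SmoothFlow n T f) {t : ℝ} (ht : t ∈ timeInterval T) (p : M) :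
    ContDiffAt ℝ ∞ (localRep (f t) p) (coord p : E n) := by
  have h1 : ContDiffOn ℝ ∞ (localRep (f t) p) (extChartAt 𝓘(ℝ, E n) p).target :=
    (contDiffOn_chartRep hf p).comp (contDiff_const.prodMk contDiff_id).contDiffOn
      fun y hy => ⟨ht, hy⟩
  exact h1.contDiffAt ((isOpen_target p).mem_nhds (coord_mem p))

/-- The gradient of `β + 2 (t - t₀) θ` has the length of `𝐱^⊥ + 2 (t₀ - t) H`. -/
lemma norm_normal_sq (hn : 0 < n) (hT : 0 < T) (hF : IsLagrangianMCF T F) {θ : ℝ → M → ℝ}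
    (hθ : IsAngleFamily T F o θ) {t : ℝ} (ht : t ∈ timeInterval T) {p : M} {f : M → ℝ}
    (hf : gradient (F t) f p = tangentialPart (F t) p (J (F t p))) (c : ℝ) :
    ‖normalPart (F t) p (F t p) + (-c) • meanCurvature (F t) p‖ ^ 2 =
      ∑ i, ∑ j, (gramMat (frameAt (F t) p (coord p)))⁻¹ i j *
        ((pderiv i (localRep f p) (coord p) + c * pderiv i (localRep (θ t) p) (coord p)) *
          (pderiv j (localRep f p) (coord p) + c * pderiv j (localRep (θ t) p) (coord p))) := by
  have hz := coord_mem_dom (n := n) ht p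
  have he := hF.isLagFrame hz
  rw [hF.tangentialPart_eq ht] at hf
  have h1 := pderiv_eq_of_gradient_eq he hf
  have h2 : ∀ i, inner ℝ (J (frameAt (F t) p (coord p) i))
      (norComp (frameAt (F t) p (coord p)) (F t p)) =
        - inner ℝ (J (F t p)) (frameAt (F t) p (coord p) i) := by
    intro i
    have h3 : inner ℝ (J (frameAt (F t) p (coord p) i))
        (tanComp (frameAt (F t) p (coord p)) (F t p)) = 0 := by
      rw [inner_tanComp_right]; simp [he.lagrangian]
    have h4 : inner ℝ (J (frameAt (F t) p (coord p) i)) (F t p) = _ :=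
      congrArg (fun v => inner ℝ (J (frameAt (F t) p (coord p) i)) v) (he.expansion (F t p))
    rw [inner_add_right, h3, zero_add] at h4
    rw [← h4, inner_J_left, real_inner_comm]
  rw [hF.normalPart_eq ht, he.normSq_of_orthogonal]
  -- A normal vector is determined by its pairings with `J∂ᵢF`. Those of `𝐱^⊥ - cH` are the
  -- derivatives of `f + cθ` up to sign, and the sign disappears in the square.
  · have h5 : ∀ i, inner ℝ (J (frameAt (F t) p (coord p) i))
        (norComp (frameAt (F t) p (coord p)) (F t p) + (-c) • meanCurvature (F t) p) =
        -(pderiv i (localRep f p) (coord p) + c * pderiv i (localRep (θ t) p) (coord p)) := by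
      intro i
      rw [inner_add_right, real_inner_smul_right, h2, hθ.inner_J_meanCurvature hn hT hF ht, h1,
        SmoothFlow.pderiv_localRep hθ.1 hz]
      ring
    simp only [h5]
    refine Finset.sum_congr rfl fun i _ => Finset.sum_congr rfl fun j _ => ?_
    ring
  · intro i
    rw [inner_add_right, real_inner_smul_right, he.inner_norComp, hF.inner_meanCurvature ht]
    simp

/-- Near each point `u = cos(κw)` with `w = b + 2(t - t₀)θ` for a smooth branch `b`, and `w` solves
the heat equation; the extra term is `κ²|∇w|²u`. -/
lemma exists_cos_evolution (hn : 0 < n) (hT : 0 < T) (hF : IsLagrangianMCF T F) {θ : ℝ → M → ℝ}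
    (hθ : IsAngleFamily T F o θ) {a : ℝ} {β : ℝ → M → AddCircle (2 * Real.pi * a)}
    (hβ : IsLiouvillePrimitive T F β) (hev : LiouvilleEvolution T F θ β) (t₀ : ℝ) (k : ℤ) :
    ∃ u : ℝ → M → ℝ,
      (∀ t p (b : ℝ), (b : AddCircle (2 * Real.pi * a)) = β t p →
        u t p = Real.cos (k * (b + 2 * (t - t₀) * θ t p) / divisor a)) ∧
      SmoothFlow n T u ∧
      ∀ t ∈ timeInterval T, ∀ p,
        HasDerivWithinAt (fun s => u s p)
          (laplacian (F t) (u t) p + u t p *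
            ‖((k : ℝ) / divisor a) • (normalPart (F t) p (F t p) +
              (2 * (t₀ - t)) • meanCurvature (F t) p)‖ ^ 2) (timeInterval T) t := by
  have hsurj : ∀ t p, ∃ b : ℝ, (b : AddCircle (2 * Real.pi * a)) = β t p :=
    fun t p => QuotientAddGroup.mk_surjective (β t p)
  -- `B` is a possibly discontinuous choice of representatives; `hval` shows that `u` does not
  -- depend on it.
  choose B hB using hsurj
  set u : ℝ → M → ℝ := fun t p => Real.cos (k * (B t p + 2 * (t - t₀) * θ t p) / divisor a)
    with hu
  have hval : ∀ t p (b : ℝ), (b : AddCircle (2 * Real.pi * a)) = β t p →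
      u t p = Real.cos (k * (b + 2 * (t - t₀) * θ t p) / divisor a) :=
    fun t p b hb => cos_eq_of_coe_eq ((hB t p).trans hb.symm) k _
  set κ : ℝ := k / divisor a with hκ
  have hbr : ∀ U b, IsBranch (n := n) T β U b → ∀ t p, (t, p) ∈ U ∩ spacetime M T →
      u t p = Real.cos (κ * (b t p + 2 * (t - t₀) * θ t p)) := by
    intro U b hb t p htp
    rw [hval t p _ (hb.lift t p htp), hκ]
    congr 1; ring
  refine ⟨u, hval, ?_, ?_⟩
  · rintro z hz
    obtain ⟨U, b, hzU, hb⟩ := hβ.exists_branch z hz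
    have h1 : ContMDiffOn (𝓘(ℝ, ℝ).prod 𝓘(ℝ, E n)) 𝓘(ℝ, ℝ) ∞ (fun z : ℝ × M =>
        Real.cos (κ * (b z.1 z.2 + 2 * (z.1 - t₀) * θ z.1 z.2))) (U ∩ spacetime M T) := by
      refine Real.contDiff_cos.contMDiff.comp_contMDiffOn ?_
      refine contMDiffOn_const.mul (hb.smooth.add (ContMDiffOn.mul ?_
        (hθ.1.mono inter_subset_right)))
      exact contMDiffOn_const.mul (contMDiffOn_fst.sub contMDiffOn_const)
    have h2 : ContMDiffOn (𝓘(ℝ, ℝ).prod 𝓘(ℝ, E n)) 𝓘(ℝ, ℝ) ∞ (uncurry u)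
        (U ∩ spacetime M T) := h1.congr fun y hy => hbr U b hb y.1 y.2 hy
    refine (h2 z ⟨hzU, hz⟩).mono_of_mem_nhdsWithin ?_
    exact Filter.inter_mem (mem_nhdsWithin_of_mem_nhds (hb.isOpen.mem_nhds hzU))
      self_mem_nhdsWithin
  · intro t ht p
    obtain ⟨U, b, hzU, hb⟩ := hβ.exists_branch (t, p) ⟨ht, mem_univ _⟩
    have htp : (t, p) ∈ U ∩ spacetime M T := ⟨hzU, ht, mem_univ _⟩
    set c : ℝ := 2 * (t - t₀) with hc
    have hbs := hb.contDiffAt_localRep htp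
    have hθs := SmoothFlow.contDiffAt_localRep hθ.1 ht p
    have hws : ContDiffAt ℝ ∞ (localRep (fun q => b t q + c * θ t q) p) (coord p : E n) :=
      hbs.add (contDiffAt_const.mul hθs)
    have hΔ : laplacian (F t) (u t) p =
        laplacian (F t) (fun q => Real.cos (κ * (b t q + c * θ t q))) p := by
      apply laplacian_congr
      have h1 : ContinuousAt (fun y : E n => (t, (extChartAt 𝓘(ℝ, E n) p).symm y)) (coord p) :=
        continuousAt_const.prodMk (continuousAt_extChartAt_symm p)
      have h2 := h1.preimage_mem_nhds (hb.isOpen.mem_nhds (by rw [symm_coord]; exact hzU))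
      filter_upwards [h2] with y hy
      exact hbr U b hb t _ ⟨hy, ht, mem_univ _⟩
    have hpd : ∀ j, pderiv j (localRep (fun q => b t q + c * θ t q) p) (coord p) =
        pderiv j (localRep (b t) p) (coord p) + c * pderiv j (localRep (θ t) p) (coord p) :=
      fun j => pderiv_add_const_mul (hbs.differentiableAt (by simp))
        (hθs.differentiableAt (by simp)) c j
    have hnorm := norm_normal_sq hn hT hF hθ ht (hβ.gradient_eq U b hb t p htp) c
    have hneg : 2 * (t₀ - t) = -c := by rw [hc]; ring
    rw [hΔ, laplacian_cos hws, laplacian_add_const_mul hbs hθs, norm_smul, mul_pow, hneg, hnorm,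
      Real.norm_eq_abs, sq_abs, hbr U b hb t p htp]
    simp only [hpd]
    have hd1 := hev U b hb t p htp
    have hd2 := hθ.heat hn hT hF ht p
    have hd3 : HasDerivWithinAt (fun s : ℝ => 2 * (s - t₀)) 2 (timeInterval T) t := by
      simpa using ((hasDerivWithinAt_id t (timeInterval T)).sub_const t₀).const_mul 2
    -- The factor `2(s - t₀)` has derivative `2`, and the resulting `2θ` cancels the `-2θ` in the
    -- evolution of `β`.
    have hd4 : HasDerivWithinAt (fun s => b s p + 2 * (s - t₀) * θ s p)
        (laplacian (F t) (b t) p - 2 * θ t p + (2 * θ t p + c * laplacian (F t) (θ t) p))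
        (timeInterval T) t := hd1.add (hd3.mul hd2)
    have hd5 : HasDerivWithinAt (fun s => u s p)
        (-Real.sin (κ * (b t p + c * θ t p)) * (κ * (laplacian (F t) (b t) p - 2 * θ t p +
          (2 * θ t p + c * laplacian (F t) (θ t) p)))) (timeInterval T) t := by
      refine (hd4.const_mul κ).cos.congr_of_eventuallyEq ?_ (hbr U b hb t p htp)
      have h1 : ContinuousAt (fun s : ℝ => (s, p)) t := by fun_prop
      filter_upwards [self_mem_nhdsWithin,
        mem_nhdsWithin_of_mem_nhds (h1.preimage_mem_nhds (hb.isOpen.mem_nhds hzU))] with s hs hsU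
      exact hbr U b hb s p ⟨hsU, hs, mem_univ _⟩
    refine hd5.congr_deriv ?_
    ring

end Evolution

end

end LagrangianMCF

theorem mainTheorem6 {n : ℕ} (hn : 0 < n) {M : Type*} [TopologicalSpace M] [T2Space M]
    [SecondCountableTopology M] [ChartedSpace (LagrangianMCF.E n) M]
    [IsManifold 𝓘(ℝ, LagrangianMCF.E n) ∞ M]
    (o : ∀ p : M, Orientation ℝ (TangentSpace 𝓘(ℝ, LagrangianMCF.E n) p) (Fin n))
    (T : EReal) (hT : 0 < T) (F : ℝ → M → LagrangianMCF.V n)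
    (hF : LagrangianMCF.IsLagrangianMCF T F)
    (hmaslov : LagrangianMCF.IsZeroMaslov (F 0) o)
    (a : ℝ) (hrational : LagrangianMCF.IsRational (F 0) a) :
    (∃ θ : ℝ → M → ℝ, LagrangianMCF.IsAngleFamily T F o θ) ∧
    ∀ θ : ℝ → M → ℝ, LagrangianMCF.IsAngleFamily T F o θ →
      (∀ t ∈ LagrangianMCF.timeInterval T, ∀ p,
        HasDerivWithinAt (fun s => θ s p) (LagrangianMCF.laplacian (F t) (θ t) p)
          (LagrangianMCF.timeInterval T) t) ∧
      (∃ β : ℝ → M → AddCircle (2 * Real.pi * a),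
        LagrangianMCF.IsLiouvillePrimitive T F β ∧
        LagrangianMCF.LiouvilleEvolution T F θ β) ∧
      (∀ β : ℝ → M → AddCircle (2 * Real.pi * a),
        LagrangianMCF.IsLiouvillePrimitive T F β →
        LagrangianMCF.LiouvilleEvolution T F θ β →
        ∀ (t₀ : ℝ) (k : ℤ), ∃ u : ℝ → M → ℝ,
          (∀ t p (b : ℝ), (b : AddCircle (2 * Real.pi * a)) = β t p →
            u t p = Real.cos (k * (b + 2 * (t - t₀) * θ t p) / LagrangianMCF.divisor a)) ∧
          ContMDiffOn (𝓘(ℝ, ℝ).prod 𝓘(ℝ, LagrangianMCF.E n)) 𝓘(ℝ, ℝ) ∞ (uncurry u)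
            (LagrangianMCF.spacetime M T) ∧
          ∀ t ∈ LagrangianMCF.timeInterval T, ∀ p,
            HasDerivWithinAt (fun s => u s p)
              (LagrangianMCF.laplacian (F t) (u t) p + u t p *
                ‖((k : ℝ) / LagrangianMCF.divisor a) •
                  (LagrangianMCF.normalPart (F t) p (F t p) +
                    (2 * (t₀ - t)) • LagrangianMCF.meanCurvature (F t) p)‖ ^ 2)
              (LagrangianMCF.timeInterval T) t) :=
  ⟨hF.exists_angleFamily o hT hmaslov, fun _ hθ =>
    ⟨fun _ ht p => hθ.heat hn hT hF ht p,
      LagrangianMCF.exists_liouvillePrimitive hn hT hF hrational hθ,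
      fun _ hβ hev t₀ k => LagrangianMCF.exists_cos_evolution hn hT hF hθ hβ hev t₀ k⟩⟩
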